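/- Consider the balanced transportation problem (TP) with finite sets $M$ of sources and $N$ of destinations, supplies $a_i$, demands $b_j$ with $\sum_i a_i=\sum_j b_j$ and costs $c_{ij}$: minimise $\sum_{i,j}c_{ij}x_{ij}$ subject to $\sum_j x_{ij}=a_i$, $\sum_i x_{ij}=b_j$, $x_{ij}\ge 0$. A feasible basis $B$ is the edge set of a spanning tree of the complete bipartite graph on $M\sqcup N$ such that some feasible $x$ vanishes outside $B$ (the basic feasible solution of $B$). The multipliers of $B$ satisfy $u_i+v_j=c_{ij}$ on $B$; the reduced costs are $r_{ij}=c_{ij}-u_i-v_j$. A non-basic edge $(i,j)$ forms a unique cycle with the tree; when $x_{ij}$ increases, the variables at odd positions on the tree path from $i$ to $j$ decrease by the same amount and those at even positions increase. The algorithm Iterated Inside Out starts from a feasible basis $B$ with its basic feasible solution $x$ and repeats the following. (0) If all reduced costs of non-basic variables are non-negative, return $(B,x)$. (1) Phase 1. One at a time, in any order, each non-basic variable with negative reduced cost with respect to $B$ is increased as much as possible along its cycle; the basis $B$ is kept, although a basic variable becomes $0$. The variables that became positive are called added. (2) Phase 2. One at a time, in any order, each added variable $p$ is pivoted along its cycle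 with the current basis. If the alternating sum of the costs on the cycle is at most $0$, $p$ is increased (possibly by $0$) until a basic variable is $0$; $p$ enters the basis and that variable leaves it. If the sum is positive, $p$ is decreased, either to $0$ with the basis unchanged, or (possibly by $0$) until a basic variable is $0$, which leaves the basis while $p$ enters it; whichever occurs first, with ties broken arbitrarily. (3) If the objective value has not improved since the beginning of Phase 1, an anti-cycling mechanism is run from the current basis until the objective value improves or all reduced costs are non-negative; in the latter case the current basic solution is returned. An anti-cycling mechanism is a rule that selects the next basis, possibly depending on the bases visited since it was activated, such that: it can move whenever some reduced cost is negative; each move is a simplex pivot (a variable of negative reduced cost enters, and the leaving variable is chosen by the ratio test) or a change to another basis of the same basic solution; and it never returns to a basis while the objective value stays the same. Say that Iterated Inside Out solves TP to optimality if, from every initial basic feasible solution and for all choices left open, it cannot run forever, it cannot get stuck before returning, each execution of Phases 1 and 2 ends in a basic feasible solution that is at least as good as the one at its beginning, and what it returns is a basic feasible solution that has non-negative reduced costs and is an optimal solution of TP. Proposition. (a) If TP is non-degenerate (every basic variable of every basic feasible solution is positive), then Iterated Inside Out solves TP to optimality, whatever rule is used in step (3), even none. (b) In general, Iterated Inside Out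 with any anti-cycling mechanism solves TP to optimality. (c) If all supplies and demands are positive, then for every choice of a root vertex strongly feasible bases give such a mechanism. Here a feasible basis is strongly feasible if every tree edge of value $0$, directed from its source to its destination, points towards the root; the mechanism changes to a strongly feasible basis of the same basic solution if the current basis is not strongly feasible, and otherwise performs a simplex pivot to a strongly feasible basis. -/

import Mathlib

/-- A balanced transportation problem with set of sources `M` and set of destinations `N`. -/
structure TransportationProblem (M N : Type*) [Fintype M] [Fintype N] where
  /-- supplies -/
  a : M → ℝ
  /-- demands -/
  b : N → ℝ
  /-- unit transportation costs -/
  c : M → N → ℝ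
  /-- total supply equals total demand -/
  balanced : ∑ i, a i = ∑ j, b j

namespace IteratedInsideOut

/-- The subgraph of the complete bipartite graph on the sources `Sum.inl i` and the destinations
`Sum.inr j` whose edges are the pairs in `B`. -/
def edgeGraph {M N : Type*} (B : Finset (M × N)) : SimpleGraph (M ⊕ N) :=
  SimpleGraph.fromRel
    (fun s t => ∃ i j, s = Sum.inl i ∧ t = Sum.inr j ∧ (i, j) ∈ B)

/-- The walk `P` traverses the edge `q` from its source to its destination. -/
def Forward {M N : Type*} {B : Finset (M × N)} {s t : M ⊕ N} (P : (edgeGraph B).Walk s t)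
    (q : M × N) : Prop :=
  ∃ d ∈ P.darts, d.fst = Sum.inl q.1 ∧ d.snd = Sum.inr q.2

/-- The walk `P` traverses the edge `q` from its destination to its source. -/
def Backward {M N : Type*} {B : Finset (M × N)} {s t : M ⊕ N} (P : (edgeGraph B).Walk s t)
    (q : M × N) : Prop :=
  ∃ d ∈ P.darts, d.fst = Sum.inr q.2 ∧ d.snd = Sum.inl q.1

open Classical in
/-- Let `P` be the tree path from source `p.1` to destination `p.2`. On the cycle formed by `P`
and the edge `p`, when the variable of `p` increases by one unit, the variables of the edges in
odd position on `P` (traversed from source to destination) decrease by one unit, and those of the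
edges in even position increase by one unit. -/
noncomputable def cycleCoeff {M N : Type*} {B : Finset (M × N)} (p : M × N)
    (P : (edgeGraph B).Walk (Sum.inl p.1) (Sum.inr p.2)) (q : M × N) : ℝ :=
  if q = p then 1 else if Forward P q then -1 else if Backward P q then 1 else 0

/-- The solution obtained from `x` by increasing the variable of `p` by `k` along the cycle formed
by `P` and `p` (decreasing it, if `k < 0`). -/
noncomputable def shift {M N : Type*} {B : Finset (M × N)} (x : M → N → ℝ) (p : M × N)
    (P : (edgeGraph B).Walk (Sum.inl p.1) (Sum.inr p.2)) (k : ℝ) : M → N → ℝ :=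
  fun i j => x i j + k * cycleCoeff p P (i, j)

/-- An anti-cycling mechanism is represented by the rule that tells to which bases it may move.
The first argument is the list of the bases visited since the mechanism was activated, the
current basis first; the second is the next basis. -/
abbrev Rule (M N : Type*) := List (Finset (M × N)) → Finset (M × N) → Prop

/-- The control states of the algorithm. `B` is the current basis and `x` the current solution of
the original problem, including the values of the non-basic variables that are fictitiously
removed during Phase 1. -/
inductive State (M N : Type*) where
  /-- about to compute the multipliers and the reduced costs of a basis -/
  | main (B : Finset (M × N)) (x : M → N → ℝ)
  /-- in Phase 1: `z` is the objective value at its beginning, `todo` the set of the variables that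
  still have to be considered, `added` the set of those that have become positive -/
  | phase1 (B : Finset (M × N)) (x : M → N → ℝ) (z : ℝ) (todo added : Finset (M × N))
  /-- in Phase 2: `z` is the objective value at the beginning of Phase 1, `todo` the set of the
  added variables that still have to be considered -/
  | phase2 (B : Finset (M × N)) (x : M → N → ℝ) (z : ℝ) (todo : Finset (M × N))
  /-- the anti-cycling mechanism is active; `hist` lists the bases visited since its activation,
  the current one first -/
  | antiCycle (hist : List (Finset (M × N))) (x : M → N → ℝ)
  /-- the algorithm has returned the basis `B` and its solution `x` -/
  | halted (B : Finset (M × N)) (x : M → N → ℝ)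

end IteratedInsideOut

namespace TransportationProblem

open IteratedInsideOut

variable {M N : Type*} [Fintype M] [Fintype N]

/-- The objective function. -/
def cost (T : TransportationProblem M N) (x : M → N → ℝ) : ℝ :=
  ∑ i, ∑ j, T.c i j * x i j

/-- Feasible solutions. -/
def Feasible (T : TransportationProblem M N) (x : M → N → ℝ) : Prop :=
  (∀ i, ∑ j, x i j = T.a i) ∧ (∀ j, ∑ i, x i j = T.b j) ∧ ∀ i j, 0 ≤ x i j

/-- Optimal solutions. -/
def IsOptimal (T : TransportationProblem M N) (x : M → N → ℝ) : Prop :=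
  T.Feasible x ∧ ∀ y, T.Feasible y → T.cost x ≤ T.cost y

/-- `B` is a feasible basis, that is the edge set of a spanning tree of the complete bipartite
graph, and `x` is its basic feasible solution. -/
def IsBFS (T : TransportationProblem M N) (B : Finset (M × N)) (x : M → N → ℝ) : Prop :=
  (edgeGraph B).IsTree ∧ T.Feasible x ∧ ∀ i j, (i, j) ∉ B → x i j = 0

/-- No feasible basis has a basic variable with value zero. -/
def NonDegenerate (T : TransportationProblem M N) : Prop :=
  ∀ B x, T.IsBFS B x → ∀ p ∈ B, 0 < x p.1 p.2

/-- `u`, `v` are simplex multipliers of the basis `B`. -/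
def IsMultipliers (T : TransportationProblem M N) (B : Finset (M × N)) (u : M → ℝ) (v : N → ℝ) :
    Prop :=
  ∀ p ∈ B, u p.1 + v p.2 = T.c p.1 p.2

/-- The reduced cost of the variable `p` with respect to the multipliers `u`, `v`. -/
def reducedCost (T : TransportationProblem M N) (u : M → ℝ) (v : N → ℝ) (p : M × N) : ℝ :=
  T.c p.1 p.2 - u p.1 - v p.2

/-- All non-basic variables of the basis `B` have non-negative reduced costs. -/
def ReducedCostsNonneg (T : TransportationProblem M N) (B : Finset (M × N)) : Prop :=
  ∃ u v, T.IsMultipliers B u v ∧ ∀ p ∉ B, 0 ≤ T.reducedCost u v p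

/-- The alternating sum of the cost coefficients on the cycle formed by `P` and `p`. -/
noncomputable def cycleCost (T : TransportationProblem M N) {B : Finset (M × N)} (p : M × N)
    (P : (edgeGraph B).Walk (Sum.inl p.1) (Sum.inr p.2)) : ℝ :=
  ∑ i, ∑ j, T.c i j * cycleCoeff p P (i, j)

variable [DecidableEq M] [DecidableEq N]

/-- A pivoting operation of the network simplex algorithm: a non-basic variable `p` with negative
reduced cost enters the basis `B`, and is increased along its cycle until a basic variable `q`
reaches zero, which leaves the basis. -/
def SimplexPivot (T : TransportationProblem M N) (B : Finset (M × N)) (x : M → N → ℝ)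
    (B' : Finset (M × N)) (x' : M → N → ℝ) : Prop :=
  ∃ u v, T.IsMultipliers B u v ∧ ∃ p, p ∉ B ∧ T.reducedCost u v p < 0 ∧
    ∃ P : (edgeGraph B).Walk (Sum.inl p.1) (Sum.inr p.2), P.IsPath ∧
    ∃ q, Forward P q ∧ (∀ q', Forward P q' → x q.1 q.2 ≤ x q'.1 q'.2) ∧
      x' = shift x p P (x q.1 q.2) ∧ B' = insert p (B.erase q)

/-- One elementary step of the algorithm, whose degenerate stalls are handled by the anti-cycling
mechanism `rule`. All choices that the algorithm leaves open (the order in which variables are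
considered, the leaving variable in case of ties, ...) are left open. -/
inductive Step (T : TransportationProblem M N) (rule : Rule M N) : State M N → State M N → Prop
  /-- all reduced costs are non-negative: return the current basic solution -/
  | optimal (B x) (h : T.ReducedCostsNonneg B) : Step T rule (.main B x) (.halted B x)
  /-- otherwise, start Phase 1 with all non-basic variables of negative reduced cost -/
  | startPhase1 (B x u v) (todo : Finset (M × N)) (huv : T.IsMultipliers B u v)
      (htodo : ∀ p, p ∈ todo ↔ p ∉ B ∧ T.reducedCost u v p < 0) (hne : todo.Nonempty) :
      Step T rule (.main B x) (.phase1 B x (T.cost x) todo ∅)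
  /-- Phase 1: increase the variable `p` as much as possible, without changing the basis, where the
  value of `p` does not change since a basic variable blocks it -/
  | phase1Blocked (B x z todo added p) (hp : p ∈ todo)
      (P : (edgeGraph B).Walk (Sum.inl p.1) (Sum.inr p.2)) (hP : P.IsPath)
      (hk : IsLeast {t | ∃ q, Forward P q ∧ x q.1 q.2 = t} 0) :
      Step T rule (.phase1 B x z todo added) (.phase1 B x z (todo.erase p) added)
  /-- Phase 1: increase the variable `p` as much as possible, without changing the basis, by the
  positive amount `k` -/
  | phase1Increase (B x z todo added p) (hp : p ∈ todo)
      (P : (edgeGraph B).Walk (Sum.inl p.1) (Sum.inr p.2)) (hP : P.IsPath) (k : ℝ)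
      (hk : IsLeast {t | ∃ q, Forward P q ∧ x q.1 q.2 = t} k) (hpos : 0 < k) :
      Step T rule (.phase1 B x z todo added)
        (.phase1 B (shift x p P k) z (todo.erase p) (insert p added))
  /-- Phase 1 is over: start Phase 2 with the variables that were added -/
  | startPhase2 (B x z added) : Step T rule (.phase1 B x z ∅ added) (.phase2 B x z added)
  /-- Phase 2, the costs on the cycle of `p` sum up to at most zero: increase `p` (possibly by
  zero) until the basic variable `q` is zero; `p` enters the basis and `q` leaves it -/
  | phase2Increase (B x z todo p) (hp : p ∈ todo)
      (P : (edgeGraph B).Walk (Sum.inl p.1) (Sum.inr p.2)) (hP : P.IsPath)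
      (hcost : T.cycleCost p P ≤ 0) (q) (hq : Forward P q)
      (hmin : ∀ q', Forward P q' → x q.1 q.2 ≤ x q'.1 q'.2) :
      Step T rule (.phase2 B x z todo)
        (.phase2 (insert p (B.erase q)) (shift x p P (x q.1 q.2)) z (todo.erase p))
  /-- Phase 2, the costs on the cycle of `p` have a positive sum: decrease `p` to zero, keeping the
  basis -/
  | phase2ToZero (B x z todo p) (hp : p ∈ todo)
      (P : (edgeGraph B).Walk (Sum.inl p.1) (Sum.inr p.2)) (hP : P.IsPath)
      (hcost : 0 < T.cycleCost p P)
      (hmin : ∀ q', Backward P q' → x p.1 p.2 ≤ x q'.1 q'.2) :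
      Step T rule (.phase2 B x z todo)
        (.phase2 B (shift x p P (-x p.1 p.2)) z (todo.erase p))
  /-- Phase 2, the costs on the cycle of `p` have a positive sum: decrease `p` (possibly by zero)
  until the basic variable `q` is zero; `p` enters the basis and `q` leaves it -/
  | phase2Decrease (B x z todo p) (hp : p ∈ todo)
      (P : (edgeGraph B).Walk (Sum.inl p.1) (Sum.inr p.2)) (hP : P.IsPath)
      (hcost : 0 < T.cycleCost p P) (q) (hq : Backward P q)
      (hmin : ∀ q', Backward P q' → x q.1 q.2 ≤ x q'.1 q'.2) (hle : x q.1 q.2 ≤ x p.1 p.2) :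
      Step T rule (.phase2 B x z todo)
        (.phase2 (insert p (B.erase q)) (shift x p P (-x q.1 q.2)) z (todo.erase p))
  /-- Phase 2 is over and the objective has improved: iterate -/
  | improved (B x z) (h : T.cost x < z) : Step T rule (.phase2 B x z ∅) (.main B x)
  /-- Phase 2 is over and the objective has not improved: activate the anti-cycling mechanism -/
  | stalled (B x z) (h : ¬ T.cost x < z) : Step T rule (.phase2 B x z ∅) (.antiCycle [B] x)
  /-- the anti-cycling mechanism has reached a basis with non-negative reduced costs -/
  | antiCycleOptimal (B hist x) (h : T.ReducedCostsNonneg B) :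
      Step T rule (.antiCycle (B :: hist) x) (.halted B x)
  /-- a move of the anti-cycling mechanism that improves the objective: return to the two phases -/
  | antiCycleImproved (B hist x B' x') (hB : ¬ T.ReducedCostsNonneg B)
      (hr : rule (B :: hist) B') (hx' : T.IsBFS B' x') (h : T.cost x' < T.cost x) :
      Step T rule (.antiCycle (B :: hist) x) (.main B' x')
  /-- a move of the anti-cycling mechanism that does not improve the objective -/
  | antiCycleContinue (B hist x B' x') (hB : ¬ T.ReducedCostsNonneg B)
      (hr : rule (B :: hist) B') (hx' : T.IsBFS B' x') (h : ¬ T.cost x' < T.cost x) :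
      Step T rule (.antiCycle (B :: hist) x) (.antiCycle (B' :: B :: hist) x')

/-- `T.StalledRun rule hist`: the list `hist` (latest first) is a sequence of feasible bases, all
with the same objective value, which `rule` may visit when it is activated at the last entry of
the list. -/
inductive StalledRun (T : TransportationProblem M N) (rule : Rule M N) :
    List (Finset (M × N)) → Prop
  | start (B x) (hx : T.IsBFS B x) : StalledRun T rule [B]
  | move (B hist x B' x') (h : StalledRun T rule (B :: hist)) (hB : ¬ T.ReducedCostsNonneg B)
      (hr : rule (B :: hist) B') (hx : T.IsBFS B x) (hx' : T.IsBFS B' x')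
      (hcost : T.cost x' = T.cost x) : StalledRun T rule (B' :: B :: hist)

/-- An anti-cycling mechanism for the network simplex algorithm: as long as some reduced cost is
negative it can move; each of its moves is a simplex pivot, or a change to another basis of the
same basic solution; and it never returns to a basis while the objective value does not change. -/
structure IsAntiCycling (T : TransportationProblem M N) (rule : Rule M N) : Prop where
  exists_move : ∀ B hist, T.StalledRun rule (B :: hist) → ¬ T.ReducedCostsNonneg B →
    ∃ B', rule (B :: hist) B'
  move_valid : ∀ B hist B', T.StalledRun rule (B :: hist) → ¬ T.ReducedCostsNonneg B →
    rule (B :: hist) B' → ∃ x x', T.IsBFS B x ∧ T.IsBFS B' x' ∧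
      (x' = x ∨ T.SimplexPivot B x B' x')
  no_cycle : ∀ hist, T.StalledRun rule hist → hist.Nodup

/-- A feasible basis `B` with basic solution `x` is strongly feasible with respect to `root` if,
in the spanning tree, every edge with value zero is directed (from source to destination) towards
`root`; that is, an edge which some tree path ending in `root` traverses against its direction
has a positive value. -/
def IsStronglyFeasible (T : TransportationProblem M N) (root : M ⊕ N) (B : Finset (M × N))
    (x : M → N → ℝ) : Prop :=
  T.IsBFS B x ∧ ∀ (s : M ⊕ N) (P : (edgeGraph B).Walk s root), P.IsPath →
    ∀ q, Backward P q → 0 < x q.1 q.2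

/-- The mechanism of strongly feasible bases: if the current basis is not strongly feasible, change
to a strongly feasible basis of the same basic solution; otherwise, perform a simplex pivot to a
strongly feasible basis. -/
def stronglyFeasibleRule (T : TransportationProblem M N) (root : M ⊕ N) : Rule M N :=
  fun hist B' => ∃ B rest x x', hist = B :: rest ∧ T.IsBFS B x ∧
    T.IsStronglyFeasible root B' x' ∧
    ((¬ T.IsStronglyFeasible root B x ∧ x' = x) ∨
      (T.IsStronglyFeasible root B x ∧ T.SimplexPivot B x B' x'))

/-- The algorithm with the anti-cycling mechanism `rule` solves `T` to optimality from every
initial basic feasible solution: it cannot run forever, it cannot get stuck before it stops, every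
execution of the two phases ends in a basic feasible solution that is at least as good as
before, and whatever it returns is an optimal basic feasible solution, with non-negative reduced
costs. -/
def SolvesToOptimality (T : TransportationProblem M N) (rule : Rule M N) : Prop :=
  ∀ B₀ x₀, T.IsBFS B₀ x₀ →
    (¬ ∃ run : ℕ → State M N, run 0 = .main B₀ x₀ ∧ ∀ n, T.Step rule (run n) (run (n + 1))) ∧
    (∀ s, Relation.ReflTransGen (T.Step rule) (.main B₀ x₀) s →
      (∃ s', T.Step rule s s') ∨ ∃ B x, s = .halted B x) ∧
    (∀ B x z, Relation.ReflTransGen (T.Step rule) (.main B₀ x₀) (.phase2 B x z ∅) →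
      T.IsBFS B x ∧ T.cost x ≤ z) ∧
    (∀ B x, Relation.ReflTransGen (T.Step rule) (.main B₀ x₀) (.halted B x) →
      T.IsBFS B x ∧ T.ReducedCostsNonneg B ∧ T.IsOptimal x)

end TransportationProblem

namespace IteratedInsideOut

variable {M N : Type*}

open Sum (inl inr)

/-! ### The bipartite graph of a set of edges -/

/-! Row and column sums are recorded dually, by the numbers `pair (grad φ) x` for all potentials
`φ`. Flow sent along a walk pairs with `grad φ` to the difference of the end potentials
(`pair_walkCoeff`). Hence a shift along a cycle keeps all sums (`pair_grad_cycleCoeff`), and it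
changes the cost by its amount times the reduced cost of the non-basic edge (`cost_shift`,
`cycleCost_eq_reducedCost`). Phase 1 lowers the cost with every positive increase, and Phase 2
always moves in a non-worsening direction. Exchanging edges of the cycle keeps a spanning tree
(`isTree_exchange`); once an added variable is treated, it is basic or zero, so Phase 2 ends in a
basic feasible solution.

Termination: a basis determines its solution (`IsBasicFlow.unique`) and there are finitely many
bases, so an improvement decreases the number `level` of feasible bases of smaller cost. Between
improvements the stages and the work left in each stage decrease (`Invariant.step`). Without
degeneracy the first candidate of Phase 1 increases by a positive amount, so the algorithm never
stalls; otherwise the visited bases of the mechanism are distinct and so bounded in number. What is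
returned is optimal by weak duality.

Strongly feasible bases amount to a perturbation `x + ε y`, where `y` sends one unit from every
vertex to the root. Strong feasibility is lexicographic positivity of `(x, y)` on the basis
(`isStronglyFeasible_iff`). A lexicographic ratio test preserves it
(`IsStronglyFeasible.exists_pivot`), and a degenerate pivot strictly lowers the cost of `y`
(`IsStronglyFeasible.pair_rootFlow_lt`), so no basis recurs. -/

theorem edgeGraph_adj {B : Finset (M × N)} {s t : M ⊕ N} :
    (edgeGraph B).Adj s t ↔ ∃ q ∈ B, (s = inl q.1 ∧ t = inr q.2) ∨ (s = inr q.2 ∧ t = inl q.1) := by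
  unfold edgeGraph
  rw [SimpleGraph.fromRel_adj]
  constructor
  · rintro ⟨-, ⟨i, j, rfl, rfl, h⟩ | ⟨i, j, rfl, rfl, h⟩⟩
    · exact ⟨(i, j), h, Or.inl ⟨rfl, rfl⟩⟩
    · exact ⟨(i, j), h, Or.inr ⟨rfl, rfl⟩⟩
  · rintro ⟨q, hq, ⟨rfl, rfl⟩ | ⟨rfl, rfl⟩⟩
    · exact ⟨by simp, Or.inl ⟨q.1, q.2, rfl, rfl, hq⟩⟩
    · exact ⟨by simp, Or.inr ⟨q.1, q.2, rfl, rfl, hq⟩⟩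

theorem edgeGraph_adj_inl_inr {B : Finset (M × N)} {i : M} {j : N} :
    (edgeGraph B).Adj (inl i) (inr j) ↔ (i, j) ∈ B := by
  rw [edgeGraph_adj]
  constructor
  · rintro ⟨q, hq, ⟨h₁, h₂⟩ | ⟨h₁, h₂⟩⟩
    · rw [Sum.inl.inj h₁, Sum.inr.inj h₂]
      exact hq
    · cases h₁
  · exact fun h => ⟨_, h, Or.inl ⟨rfl, rfl⟩⟩

theorem edgeGraph_mono {B B' : Finset (M × N)} (h : B ⊆ B') : edgeGraph B ≤ edgeGraph B' := by
  intro s t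
  simp only [edgeGraph_adj]
  rintro ⟨q, hq, hq'⟩
  exact ⟨q, h hq, hq'⟩

theorem edgeSet_edgeGraph (B : Finset (M × N)) :
    (edgeGraph B).edgeSet = (fun q : M × N => s(inl q.1, inr q.2)) '' (B : Set (M × N)) := by
  ext e
  induction e with
  | h s t =>
    rw [SimpleGraph.mem_edgeSet, edgeGraph_adj, Set.mem_image]
    constructor
    · rintro ⟨q, hq, ⟨rfl, rfl⟩ | ⟨rfl, rfl⟩⟩
      · exact ⟨q, hq, rfl⟩
      · exact ⟨q, hq, Sym2.eq_swap⟩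
    · rintro ⟨q, hq, h⟩
      rcases Sym2.eq_iff.1 h with ⟨h₁, h₂⟩ | ⟨h₁, h₂⟩
      · exact ⟨q, hq, Or.inl ⟨h₁.symm, h₂.symm⟩⟩
      · exact ⟨q, hq, Or.inr ⟨h₂.symm, h₁.symm⟩⟩

theorem sym2_inl_inr_injective :
    Function.Injective (fun q : M × N => (s(inl q.1, inr q.2) : Sym2 (M ⊕ N))) := by
  rintro ⟨i, j⟩ ⟨i', j'⟩ h
  simpa using h

theorem card_edgeSet_edgeGraph (B : Finset (M × N)) :
    Nat.card (edgeGraph B).edgeSet = B.card := by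
  rw [edgeSet_edgeGraph, Nat.card_image_of_injective sym2_inl_inr_injective]
  simp

theorem mem_of_forward {B : Finset (M × N)} {s t : M ⊕ N} {P : (edgeGraph B).Walk s t} {q : M × N}
    (h : Forward P q) : q ∈ B := by
  obtain ⟨d, -, h₁, h₂⟩ := h
  have := d.adj
  rw [h₁, h₂] at this
  exact edgeGraph_adj_inl_inr.1 this

theorem mem_of_backward {B : Finset (M × N)} {s t : M ⊕ N} {P : (edgeGraph B).Walk s t} {q : M × N}
    (h : Backward P q) : q ∈ B := by
  obtain ⟨d, -, h₁, h₂⟩ := h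
  have := d.adj.symm
  rw [h₁, h₂] at this
  exact edgeGraph_adj_inl_inr.1 this

theorem exists_forward {B : Finset (M × N)} {i : M} {j : N}
    (P : (edgeGraph B).Walk (inl i) (inr j)) : ∃ q, Forward P q := by
  cases P with
  | cons h P =>
    obtain ⟨q, -, ⟨h₁, h₂⟩ | ⟨h₁, -⟩⟩ := edgeGraph_adj.1 h
    · exact ⟨q, ⟨(_, _), h⟩, by simp, h₁, h₂⟩
    · cases h₁

/-- A tree stays a tree when an edge `q` on the cycle that a new edge `p` closes is replaced
by `p`. -/
theorem isTree_exchange [Fintype M] [Fintype N] [DecidableEq M] [DecidableEq N]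
    {B : Finset (M × N)} (hB : (edgeGraph B).IsTree) {p q : M × N}
    (hp : p ∉ B) {P : (edgeGraph B).Walk (inl p.1) (inr p.2)} (hP : P.IsPath)
    (hq : Forward P q ∨ Backward P q) : (edgeGraph (insert p (B.erase q))).IsTree := by
  have hqB : q ∈ B := hq.elim mem_of_forward mem_of_backward
  rw [SimpleGraph.isTree_iff_connected_and_card] at hB ⊢
  rw [card_edgeSet_edgeGraph] at hB ⊢
  refine ⟨?_, ?_⟩
  -- The path `P` closed by `p` is a cycle through `q`, so `q` is not a bridge once `p` is present,
  -- and deleting it keeps the graph connected. The number of edges is unchanged.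
  · have hle : edgeGraph B ≤ edgeGraph (insert p B) := edgeGraph_mono (Finset.subset_insert _ _)
    have hH : (edgeGraph (insert p B)).Connected := hB.1.mono hle
    have hadj : (edgeGraph (insert p B)).Adj (inr p.2) (inl p.1) :=
      (edgeGraph_adj_inl_inr.2 (Finset.mem_insert_self _ _)).symm
    have hqP : s(inl q.1, inr q.2) ∈ P.edges := by
      rcases hq with ⟨d, hd, h₁, h₂⟩ | ⟨d, hd, h₁, h₂⟩
      · rw [← h₁, ← h₂]
        exact List.mem_map.2 ⟨d, hd, rfl⟩
      · rw [← h₁, ← h₂, Sym2.eq_swap]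
        exact List.mem_map.2 ⟨d, hd, rfl⟩
    have hcyc : (SimpleGraph.Walk.cons hadj (P.mapLe hle)).IsCycle := by
      rw [SimpleGraph.Walk.cons_isCycle_iff]
      refine ⟨hP.mapLe hle, fun h => hp ?_⟩
      rw [SimpleGraph.Walk.edges_mapLe_eq_edges] at h
      exact edgeGraph_adj_inl_inr.1 (P.adj_of_mem_edges h).symm
    have hbr : ¬ (edgeGraph (insert p B)).IsBridge s(inl q.1, inr q.2) := by
      intro h
      refine (SimpleGraph.isBridge_iff_forall_cycle_notMem
        (edgeGraph_adj_inl_inr.2 (Finset.mem_insert_of_mem hqB))).1 h _ hcyc ?_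
      rw [SimpleGraph.Walk.edges_cons, SimpleGraph.Walk.edges_mapLe_eq_edges]
      exact List.mem_cons_of_mem _ hqP
    have := hH.connected_delete_edge_of_not_isBridge hbr
    refine this.mono ?_
    intro s t
    rw [SimpleGraph.deleteEdges_adj, edgeGraph_adj, edgeGraph_adj]
    rintro ⟨⟨r, hr, hst⟩, hne⟩
    refine ⟨r, ?_, hst⟩
    have hrq : r ≠ q := by
      rintro rfl
      apply hne
      rcases hst with ⟨rfl, rfl⟩ | ⟨rfl, rfl⟩
      · rfl
      · exact Sym2.eq_swap
    rcases Finset.mem_insert.1 hr with rfl | hr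
    · exact Finset.mem_insert_self _ _
    · exact Finset.mem_insert_of_mem (Finset.mem_erase.2 ⟨hrq, hr⟩)
  · rw [Finset.card_insert_of_notMem (fun h => hp (Finset.mem_of_mem_erase h)),
      Finset.card_erase_add_one hqB]
    exact hB.2

/-! ### Paths in trees -/

theorem path_unique {V : Type*} {G : SimpleGraph V} (hG : G.IsTree) {s t : V} {P Q : G.Walk s t}
    (hP : P.IsPath) (hQ : Q.IsPath) : P = Q :=
  (hG.existsUnique_path s t).unique hP hQ

/-- Of two adjacent vertices, one is the parent of the other when the tree hangs from `r`: if `s`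
lies on the path from `t`, then acyclicity keeps `t` off the path from `s`. -/
theorem path_eq_cons_or {V : Type*} {G : SimpleGraph V} (hG : G.IsTree) {s t r : V} (h : G.Adj s t)
    {P : G.Walk s r} {Q : G.Walk t r} (hP : P.IsPath) (hQ : Q.IsPath) :
    P = .cons h Q ∨ Q = .cons h.symm P := by
  by_cases hs : s ∈ Q.support
  · right
    have ht := hG.isAcyclic.ne_mem_support_of_support_of_adj_of_isPath hQ.reverse hP.reverse h.symm
      (by simpa using hs)
    rw [SimpleGraph.Walk.support_reverse, List.mem_reverse] at ht
    exact path_unique hG hQ (hP.cons ht)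
  · left
    exact path_unique hG hP (hQ.cons hs)

theorem exists_path_of_dart {V : Type*} {G : SimpleGraph V} {s r : V} {P : G.Walk s r}
    (hP : P.IsPath) {d : G.Dart} (hd : d ∈ P.darts) :
    ∃ R : G.Walk d.snd r, R.IsPath ∧ d.fst ∉ R.support := by
  induction P with
  | nil => simp at hd
  | cons h P ih =>
    rw [SimpleGraph.Walk.cons_isPath_iff] at hP
    rw [SimpleGraph.Walk.darts_cons, List.mem_cons] at hd
    rcases hd with rfl | hd
    · exact ⟨P, hP.1, hP.2⟩
    · exact ih hP.1 hd

/-- All tree paths to `r` use an edge in the direction of `r`. If two disagreed, each end of the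
edge would have a path to `r` avoiding the other end, against `path_eq_cons_or`. -/
theorem not_forward_and_backward {B : Finset (M × N)} (hB : (edgeGraph B).IsTree)
    {s t r : M ⊕ N} {P : (edgeGraph B).Walk s r} {Q : (edgeGraph B).Walk t r}
    (hP : P.IsPath) (hQ : Q.IsPath) {q : M × N} (hf : Forward P q) (hb : Backward Q q) : False := by
  have hadj := edgeGraph_adj_inl_inr.2 (mem_of_forward hf)
  obtain ⟨d, hd, h₁, h₂⟩ := hf
  obtain ⟨e, he, k₁, k₂⟩ := hb
  obtain ⟨R, hR, hR'⟩ := exists_path_of_dart hP hd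
  obtain ⟨S, hS, hS'⟩ := exists_path_of_dart hQ he
  have hde : d.snd = e.fst := h₂.trans k₁.symm
  have hed : d.fst = e.snd := h₁.trans k₂.symm
  have hadj' : (edgeGraph B).Adj d.snd e.snd := by
    rw [← hed]
    exact d.adj.symm
  rcases path_eq_cons_or hB hadj' hR hS with h | h
  · apply hR'
    rw [h, hed]
    simp
  · apply hS'
    rw [h, ← hde]
    simp

/-! ### The flow along a walk -/

open Classical in
/-- The change of the variable of `q` when one unit is sent back along the dart `d`. -/
noncomputable def dartCoeff {B : Finset (M × N)} (d : (edgeGraph B).Dart) (q : M × N) : ℝ :=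
  if d.fst = inl q.1 ∧ d.snd = inr q.2 then -1
  else if d.fst = inr q.2 ∧ d.snd = inl q.1 then 1 else 0

/-- The change of the variable of `q` when one unit is sent back along the walk `P`. -/
noncomputable def walkCoeff {B : Finset (M × N)} {s t : M ⊕ N} (P : (edgeGraph B).Walk s t)
    (q : M × N) : ℝ :=
  (P.darts.map (fun d => dartCoeff d q)).sum

theorem walkCoeff_cons {B : Finset (M × N)} {s t r : M ⊕ N} (h : (edgeGraph B).Adj s t)
    (P : (edgeGraph B).Walk t r) (q : M × N) :
    walkCoeff (.cons h P) q = dartCoeff ⟨(s, t), h⟩ q + walkCoeff P q := by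
  simp [walkCoeff]

theorem walkCoeff_eq_zero {B : Finset (M × N)} {s t : M ⊕ N} {P : (edgeGraph B).Walk s t}
    {q : M × N} (hf : ¬ Forward P q) (hb : ¬ Backward P q) : walkCoeff P q = 0 := by
  unfold walkCoeff
  apply List.sum_eq_zero
  intro a ha
  obtain ⟨d, hd, rfl⟩ := List.mem_map.1 ha
  unfold dartCoeff
  rw [if_neg (fun h => hf ⟨d, hd, h⟩), if_neg (fun h => hb ⟨d, hd, h⟩)]

theorem mem_support_of_forward {B : Finset (M × N)} {s t : M ⊕ N} {P : (edgeGraph B).Walk s t}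
    {q : M × N} (h : Forward P q) : inl q.1 ∈ P.support ∧ inr q.2 ∈ P.support := by
  obtain ⟨d, hd, h₁, h₂⟩ := h
  rw [← h₁, ← h₂]
  exact ⟨P.dart_fst_mem_support_of_mem_darts hd, P.dart_snd_mem_support_of_mem_darts hd⟩

theorem mem_support_of_backward {B : Finset (M × N)} {s t : M ⊕ N} {P : (edgeGraph B).Walk s t}
    {q : M × N} (h : Backward P q) : inl q.1 ∈ P.support ∧ inr q.2 ∈ P.support := by
  obtain ⟨d, hd, h₁, h₂⟩ := h
  rw [← h₁, ← h₂]
  exact ⟨P.dart_snd_mem_support_of_mem_darts hd, P.dart_fst_mem_support_of_mem_darts hd⟩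

open Classical in
-- The sum over darts telescopes against potentials, while the case distinction is the form used by
-- `cycleCoeff`. They agree on a path because it visits no vertex twice, hence no edge twice.
theorem walkCoeff_of_isPath {B : Finset (M × N)} {s t : M ⊕ N} {P : (edgeGraph B).Walk s t}
    (hP : P.IsPath) (q : M × N) :
    walkCoeff P q = if Forward P q then -1 else if Backward P q then 1 else 0 := by
  induction P with
  | nil => simp [walkCoeff, Forward, Backward]
  | @cons s t r h P ih =>
    rw [SimpleGraph.Walk.cons_isPath_iff] at hP
    have hF : Forward (.cons h P) q ↔ (s = inl q.1 ∧ t = inr q.2) ∨ Forward P q := by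
      simp [Forward]
    have hB : Backward (.cons h P) q ↔ (s = inr q.2 ∧ t = inl q.1) ∨ Backward P q := by
      simp [Backward]
    rw [walkCoeff_cons]
    by_cases h₁ : s = inl q.1 ∧ t = inr q.2
    · have hf : ¬ Forward P q := fun hf => hP.2 (h₁.1 ▸ (mem_support_of_forward hf).1)
      have hb : ¬ Backward P q := fun hb => hP.2 (h₁.1 ▸ (mem_support_of_backward hb).1)
      rw [if_pos (hF.2 (Or.inl h₁)), walkCoeff_eq_zero hf hb, dartCoeff, if_pos h₁, add_zero]
    · by_cases h₂ : s = inr q.2 ∧ t = inl q.1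
      · have hf : ¬ Forward P q := fun hf => hP.2 (h₂.1 ▸ (mem_support_of_forward hf).2)
        have hb : ¬ Backward P q := fun hb => hP.2 (h₂.1 ▸ (mem_support_of_backward hb).2)
        rw [if_neg (by tauto), if_pos (hB.2 (Or.inl h₂)), walkCoeff_eq_zero hf hb, dartCoeff,
          if_neg h₁, if_pos h₂, add_zero]
      · rw [dartCoeff, if_neg h₁, if_neg h₂, zero_add, ih hP.1]
        simp only [hF, hB, h₁, h₂, false_or]

theorem walkCoeff_of_forward {B : Finset (M × N)} {s t : M ⊕ N} {P : (edgeGraph B).Walk s t}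
    (hP : P.IsPath) {q : M × N} (h : Forward P q) : walkCoeff P q = -1 := by
  rw [walkCoeff_of_isPath hP, if_pos h]

theorem walkCoeff_of_backward {B : Finset (M × N)} {s t : M ⊕ N} (hB : (edgeGraph B).IsTree)
    {P : (edgeGraph B).Walk s t} (hP : P.IsPath) {q : M × N} (h : Backward P q) :
    walkCoeff P q = 1 := by
  rw [walkCoeff_of_isPath hP, if_neg (fun hf => not_forward_and_backward hB hP hP hf h), if_pos h]

theorem walkCoeff_eq_zero_of_notMem {B : Finset (M × N)} {s t : M ⊕ N}
    (P : (edgeGraph B).Walk s t) {q : M × N} (h : q ∉ B) : walkCoeff P q = 0 :=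
  walkCoeff_eq_zero (fun hf => h (mem_of_forward hf)) (fun hb => h (mem_of_backward hb))

/-! ### Cycle coefficients and shifted solutions -/

theorem cycleCoeff_eq {B : Finset (M × N)} {p : M × N}
    {P : (edgeGraph B).Walk (inl p.1) (inr p.2)} (hP : P.IsPath) {q : M × N} (h : q ≠ p) :
    cycleCoeff p P q = walkCoeff P q := by
  rw [cycleCoeff, if_neg h, walkCoeff_of_isPath hP]

theorem cycleCoeff_self {B : Finset (M × N)} {p : M × N}
    (P : (edgeGraph B).Walk (inl p.1) (inr p.2)) : cycleCoeff p P p = 1 :=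
  if_pos rfl

theorem cycleCoeff_of_forward {B : Finset (M × N)} {p : M × N} (hp : p ∉ B)
    {P : (edgeGraph B).Walk (inl p.1) (inr p.2)} {q : M × N} (h : Forward P q) :
    cycleCoeff p P q = -1 := by
  rw [cycleCoeff, if_neg (by rintro rfl; exact hp (mem_of_forward h)), if_pos h]

theorem cycleCoeff_of_backward {B : Finset (M × N)} (hB : (edgeGraph B).IsTree) {p : M × N}
    (hp : p ∉ B) {P : (edgeGraph B).Walk (inl p.1) (inr p.2)} (hP : P.IsPath) {q : M × N}
    (h : Backward P q) : cycleCoeff p P q = 1 := by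
  rw [cycleCoeff_eq hP (by rintro rfl; exact hp (mem_of_backward h)),
    walkCoeff_of_backward hB hP h]

theorem cycleCoeff_eq_zero {B : Finset (M × N)} {p : M × N}
    {P : (edgeGraph B).Walk (inl p.1) (inr p.2)} {q : M × N} (h : q ≠ p) (hf : ¬ Forward P q)
    (hb : ¬ Backward P q) : cycleCoeff p P q = 0 := by
  rw [cycleCoeff, if_neg h, if_neg hf, if_neg hb]

theorem shift_eq_of_notMem {B : Finset (M × N)} {x : M → N → ℝ} {p q : M × N}
    {P : (edgeGraph B).Walk (inl p.1) (inr p.2)} {k : ℝ} (hq : q ∉ B) (hqp : q ≠ p) :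
    shift x p P k q.1 q.2 = x q.1 q.2 := by
  rw [shift, cycleCoeff_eq_zero hqp (fun h => hq (mem_of_forward h))
    (fun h => hq (mem_of_backward h)), mul_zero, add_zero]

theorem shift_self {B : Finset (M × N)} {x : M → N → ℝ} {p : M × N}
    {P : (edgeGraph B).Walk (inl p.1) (inr p.2)} {k : ℝ} :
    shift x p P k p.1 p.2 = x p.1 p.2 + k := by
  rw [shift, cycleCoeff_self, mul_one]

theorem shift_forward {B : Finset (M × N)} {x : M → N → ℝ} {p q : M × N} (hp : p ∉ B)
    {P : (edgeGraph B).Walk (inl p.1) (inr p.2)} {k : ℝ} (hq : Forward P q) :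
    shift x p P k q.1 q.2 = x q.1 q.2 - k := by
  rw [shift, cycleCoeff_of_forward hp hq]
  ring

theorem shift_backward {B : Finset (M × N)} (hB : (edgeGraph B).IsTree) {x : M → N → ℝ}
    {p q : M × N} (hp : p ∉ B) {P : (edgeGraph B).Walk (inl p.1) (inr p.2)} (hP : P.IsPath) {k : ℝ}
    (hq : Backward P q) : shift x p P k q.1 q.2 = x q.1 q.2 + k := by
  rw [shift, cycleCoeff_of_backward hB hp hP hq, mul_one]

theorem exists_min_forward [Finite M] [Finite N] {B : Finset (M × N)} {i : M} {j : N}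
    (P : (edgeGraph B).Walk (inl i) (inr j)) {α : Type*} [LinearOrder α] (f : M × N → α) :
    ∃ q, Forward P q ∧ ∀ q', Forward P q' → f q ≤ f q' := by
  obtain ⟨q, hq, hmin⟩ := Set.exists_min_image {q | Forward P q} f (Set.toFinite _)
    (exists_forward P)
  exact ⟨q, hq, hmin⟩

/-- Keeps the support condition of Phase 2: only basic variables and added variables still to be
treated may be nonzero. The edge `p` passes from the second kind to the first, and `q` may leave as
it is at zero. -/
theorem vanish_exchange [DecidableEq M] [DecidableEq N] {B todo : Finset (M × N)}
    {x : M → N → ℝ} {p q : M × N} {P : (edgeGraph B).Walk (inl p.1) (inr p.2)} {k : ℝ}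
    (hx : ∀ r ∉ B, r ∉ todo → x r.1 r.2 = 0) (hq : shift x p P k q.1 q.2 = 0) (r : M × N)
    (hr : r ∉ insert p (B.erase q)) (hr' : r ∉ todo.erase p) : shift x p P k r.1 r.2 = 0 := by
  rw [Finset.mem_insert, Finset.mem_erase, not_or, not_and] at hr
  by_cases hrq : r = q
  · rw [hrq, hq]
  · rw [shift_eq_of_notMem (hr.2 hrq) hr.1]
    exact hx r (hr.2 hrq) fun h => hr' (Finset.mem_erase.2 ⟨hr.1, h⟩)

theorem notMem_exchange [DecidableEq M] [DecidableEq N] {B todo : Finset (M × N)}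
    {p q : M × N} (h : ∀ r ∈ todo, r ∉ B)
    (r : M × N) (hr : r ∈ todo.erase p) : r ∉ insert p (B.erase q) := by
  rw [Finset.mem_insert, Finset.mem_erase, not_or, not_and]
  exact ⟨Finset.ne_of_mem_erase hr, fun _ => h r (Finset.mem_of_mem_erase hr)⟩

end IteratedInsideOut

namespace IteratedInsideOut

variable {M N : Type*} [Fintype M] [Fintype N]

open Sum (inl inr)

/-! ### Flows and potentials -/

/-- The bilinear pairing of costs and flows. -/
def pair (c x : M → N → ℝ) : ℝ := ∑ i, ∑ j, c i j * x i j

/-- The potential differences along the edges. -/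
def grad (φ : M ⊕ N → ℝ) : M → N → ℝ := fun i j => φ (inl i) - φ (inr j)

/-- The row and column sums of `x` are those encoded in the functional `D` on potentials. -/
def IsFlow (D : (M ⊕ N → ℝ) → ℝ) (x : M → N → ℝ) : Prop := ∀ φ, pair (grad φ) x = D φ

/-- `x` is a flow with the row and column sums encoded in `D` which vanishes outside `B`. -/
def IsBasicFlow (D : (M ⊕ N → ℝ) → ℝ) (B : Finset (M × N)) (x : M → N → ℝ) : Prop :=
  IsFlow D x ∧ ∀ q ∉ B, x q.1 q.2 = 0

theorem pair_eq_sum (c x : M → N → ℝ) : pair c x = ∑ q : M × N, c q.1 q.2 * x q.1 q.2 := by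
  rw [Fintype.sum_prod_type]
  rfl

theorem pair_add_mul (c x y : M → N → ℝ) (k : ℝ) :
    pair c (fun i j => x i j + k * y i j) = pair c x + k * pair c y := by
  simp only [pair_eq_sum, Finset.mul_sum, ← Finset.sum_add_distrib]
  exact Finset.sum_congr rfl fun q _ => by ring

theorem pair_sub (c x y : M → N → ℝ) :
    pair c (fun i j => x i j - y i j) = pair c x - pair c y := by
  simp only [pair_eq_sum, ← Finset.sum_sub_distrib]
  exact Finset.sum_congr rfl fun q _ => by ring

theorem pair_sub_left (c d x : M → N → ℝ) :
    pair (fun i j => c i j - d i j) x = pair c x - pair d x := by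
  simp only [pair_eq_sum, ← Finset.sum_sub_distrib]
  exact Finset.sum_congr rfl fun q _ => by ring

theorem pair_congr {B : Finset (M × N)} {c d x : M → N → ℝ} (h : ∀ q ∈ B, c q.1 q.2 = d q.1 q.2)
    (hx : ∀ q ∉ B, x q.1 q.2 = 0) : pair c x = pair d x := by
  rw [pair_eq_sum, pair_eq_sum]
  refine Finset.sum_congr rfl fun q _ => ?_
  by_cases hq : q ∈ B
  · rw [h q hq]
  · rw [hx q hq, mul_zero, mul_zero]

theorem pair_dartCoeff {B : Finset (M × N)} (d : (edgeGraph B).Dart) (φ : M ⊕ N → ℝ) :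
    pair (grad φ) (fun i j => dartCoeff d (i, j)) = φ d.snd - φ d.fst := by
  rw [pair_eq_sum]
  obtain ⟨q, -, ⟨h₁, h₂⟩ | ⟨h₁, h₂⟩⟩ := edgeGraph_adj.1 d.adj
  · rw [Finset.sum_eq_single q]
    · rw [dartCoeff, if_pos ⟨h₁, h₂⟩, grad, h₁, h₂]
      ring
    · intro r _ hr
      rw [dartCoeff, if_neg, if_neg, mul_zero]
      · rw [h₁]
        rintro ⟨h, -⟩
        cases h
      · rw [h₁, h₂]
        rintro ⟨h, h'⟩
        exact hr (Prod.ext (Sum.inl.inj h).symm (Sum.inr.inj h').symm)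
    · exact fun h => absurd (Finset.mem_univ _) h
  · rw [Finset.sum_eq_single q]
    · rw [dartCoeff, if_neg, if_pos ⟨h₁, h₂⟩, grad, h₁, h₂]
      · ring
      · rw [h₁]
        rintro ⟨h, -⟩
        cases h
    · intro r _ hr
      rw [dartCoeff, if_neg, if_neg, mul_zero]
      · rw [h₁, h₂]
        rintro ⟨h, h'⟩
        exact hr (Prod.ext (Sum.inl.inj h').symm (Sum.inr.inj h).symm)
      · rw [h₁]
        rintro ⟨h, -⟩
        cases h
    · exact fun h => absurd (Finset.mem_univ _) h

theorem pair_walkCoeff_cons {B : Finset (M × N)} {s t r : M ⊕ N} (h : (edgeGraph B).Adj s t)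
    (P : (edgeGraph B).Walk t r) (c : M → N → ℝ) :
    pair c (fun i j => walkCoeff (.cons h P) (i, j)) =
      pair c (fun i j => dartCoeff ⟨(s, t), h⟩ (i, j)) + pair c (fun i j => walkCoeff P (i, j)) := by
  simp only [pair_eq_sum, walkCoeff_cons, mul_add, Finset.sum_add_distrib]

theorem pair_walkCoeff {B : Finset (M × N)} {s t : M ⊕ N} (P : (edgeGraph B).Walk s t)
    (φ : M ⊕ N → ℝ) : pair (grad φ) (fun i j => walkCoeff P (i, j)) = φ t - φ s := by
  induction P with
  | nil => simp [pair, walkCoeff]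
  | cons h P ih =>
    rw [pair_walkCoeff_cons, ih, pair_dartCoeff]
    ring

theorem pair_cycleCoeff {B : Finset (M × N)} {p : M × N} (hp : p ∉ B)
    {P : (edgeGraph B).Walk (inl p.1) (inr p.2)} (hP : P.IsPath) (c : M → N → ℝ) :
    pair c (fun i j => cycleCoeff p P (i, j)) =
      c p.1 p.2 + pair c (fun i j => walkCoeff P (i, j)) := by
  classical
  rw [pair_eq_sum, pair_eq_sum, ← Finset.add_sum_erase _ _ (Finset.mem_univ p),
    ← Finset.add_sum_erase (Finset.univ) (fun q : M × N => c q.1 q.2 * walkCoeff P (q.1, q.2))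
      (Finset.mem_univ p), cycleCoeff_self, walkCoeff_eq_zero_of_notMem P hp, mul_one, mul_zero,
    zero_add]
  congr 1
  refine Finset.sum_congr rfl fun q hq => ?_
  rw [cycleCoeff_eq hP (Finset.ne_of_mem_erase hq)]

theorem pair_grad_cycleCoeff {B : Finset (M × N)} {p : M × N} (hp : p ∉ B)
    {P : (edgeGraph B).Walk (inl p.1) (inr p.2)} (hP : P.IsPath) (φ : M ⊕ N → ℝ) :
    pair (grad φ) (fun i j => cycleCoeff p P (i, j)) = 0 := by
  rw [pair_cycleCoeff hp hP, pair_walkCoeff, grad]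
  ring

theorem pair_shift {B : Finset (M × N)} {p : M × N} (c x : M → N → ℝ)
    (P : (edgeGraph B).Walk (inl p.1) (inr p.2)) (k : ℝ) :
    pair c (shift x p P k) = pair c x + k * pair c (fun i j => cycleCoeff p P (i, j)) :=
  pair_add_mul c x _ k

theorem IsFlow.shift {D : (M ⊕ N → ℝ) → ℝ} {x : M → N → ℝ} (hx : IsFlow D x)
    {B : Finset (M × N)} {p : M × N} (hp : p ∉ B)
    {P : (edgeGraph B).Walk (inl p.1) (inr p.2)} (hP : P.IsPath) (k : ℝ) :
    IsFlow D (shift x p P k) := by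
  intro φ
  rw [pair_shift, pair_grad_cycleCoeff hp hP, hx φ, mul_zero, add_zero]

/-- The potential of a vertex is the signed cost of its tree path to `r`, edges traversed from
source to destination counting positively. The paths of adjacent vertices differ by the edge joining
them. -/
theorem exists_potential {B : Finset (M × N)} (hB : (edgeGraph B).IsTree) (c : M → N → ℝ) :
    ∃ φ : M ⊕ N → ℝ, ∀ q ∈ B, grad φ q.1 q.2 = c q.1 q.2 := by
  classical
  obtain ⟨r⟩ := hB.connected.nonempty
  choose P hP using fun s => (hB.existsUnique_path s r).exists
  refine ⟨fun s => - pair c (fun i j => walkCoeff (P s) (i, j)), fun q hq => ?_⟩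
  have hadj : (edgeGraph B).Adj (inl q.1) (inr q.2) := edgeGraph_adj_inl_inr.2 hq
  have key₁ : pair c (fun i j => dartCoeff ⟨(inl q.1, inr q.2), hadj⟩ (i, j)) = - c q.1 q.2 := by
    rw [pair_eq_sum, Finset.sum_eq_single q]
    · simp [dartCoeff]
    · intro r _ hr
      have : ¬ (q.1 = r.1 ∧ q.2 = r.2) := fun h => hr (Prod.ext h.1.symm h.2.symm)
      simp [dartCoeff, this]
    · exact fun h => absurd (Finset.mem_univ _) h
  have key₂ : pair c (fun i j => dartCoeff ⟨(inr q.2, inl q.1), hadj.symm⟩ (i, j)) = c q.1 q.2 := by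
    rw [pair_eq_sum, Finset.sum_eq_single q]
    · simp [dartCoeff]
    · intro r _ hr
      have : ¬ (q.2 = r.2 ∧ q.1 = r.1) := fun h => hr (Prod.ext h.2.symm h.1.symm)
      simp [dartCoeff, this]
    · exact fun h => absurd (Finset.mem_univ _) h
  simp only [grad]
  rcases path_eq_cons_or hB hadj (hP (inl q.1)) (hP (inr q.2)) with h | h
  · rw [h, pair_walkCoeff_cons, key₁]
    ring
  · rw [h, pair_walkCoeff_cons, key₂]
    ring

/-- The difference of the two flows vanishes outside the tree, so on its support it is itself a
potential difference. As it has zero row and column sums, it is orthogonal to every `grad φ`, hence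
to itself. -/
theorem IsBasicFlow.unique {D : (M ⊕ N → ℝ) → ℝ} {B : Finset (M × N)}
    (hB : (edgeGraph B).IsTree) {x y : M → N → ℝ} (hx : IsBasicFlow D B x)
    (hy : IsBasicFlow D B y) : x = y := by
  obtain ⟨φ, hφ⟩ := exists_potential hB (fun i j => x i j - y i j)
  have h₀ : ∀ q ∉ B, x q.1 q.2 - y q.1 q.2 = 0 := fun q hq => by
    rw [hx.2 q hq, hy.2 q hq, sub_zero]
  have h : pair (fun i j => x i j - y i j) (fun i j => x i j - y i j) = 0 := by
    rw [← pair_congr (x := fun i j => x i j - y i j) hφ h₀, pair_sub, hx.1 φ, hy.1 φ, sub_self]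
  rw [pair_eq_sum, Finset.sum_eq_zero_iff_of_nonneg (fun q _ => mul_self_nonneg _)] at h
  funext i j
  exact sub_eq_zero.1 (mul_self_eq_zero.1 (h (i, j) (Finset.mem_univ _)))

/-! ### The flow sending one unit from every vertex to a root -/

/-- The functional of the flows that send one unit from every vertex to `root`. -/
def rootDemand (root : M ⊕ N) (φ : M ⊕ N → ℝ) : ℝ := ∑ s, (φ s - φ root)

/-- Superpose the tree paths from all vertices to the root. By `not_forward_and_backward` their
contributions to an edge never cancel, and each tree edge lies on the path of one of its ends. So
the sign of the flow shows whether an edge points towards the root. -/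
theorem exists_rootFlow {B : Finset (M × N)} (hB : (edgeGraph B).IsTree) (root : M ⊕ N) :
    ∃ y : M → N → ℝ, IsBasicFlow (rootDemand root) B y ∧ (∀ q ∈ B, y q.1 q.2 ≠ 0) ∧
      ∀ q : M × N, y q.1 q.2 < 0 ↔
        ∃ (s : M ⊕ N) (P : (edgeGraph B).Walk s root), P.IsPath ∧ Backward P q := by
  choose P hP using fun s => (hB.existsUnique_path s root).exists
  set y : M → N → ℝ := fun i j => ∑ s, - walkCoeff (P s) (i, j) with hy
  have hneg : ∀ q s, Backward (P s) q → y q.1 q.2 < 0 := by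
    intro q s hs
    refine Finset.sum_neg' (fun t _ => ?_) ⟨s, Finset.mem_univ _, ?_⟩
    · have hf : ¬ Forward (P t) q := fun hf => not_forward_and_backward hB (hP t) (hP s) hf hs
      rw [walkCoeff_of_isPath (hP t), if_neg hf]
      split_ifs <;> norm_num
    · rw [walkCoeff_of_backward hB (hP s) hs]
      norm_num
  have hpos : ∀ q s, Forward (P s) q → 0 < y q.1 q.2 := by
    intro q s hs
    refine Finset.sum_pos' (fun t _ => ?_) ⟨s, Finset.mem_univ _, ?_⟩
    · have hb : ¬ Backward (P t) q := fun hb => not_forward_and_backward hB (hP s) (hP t) hs hb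
      rw [walkCoeff_of_isPath (hP t), if_neg hb]
      split_ifs <;> norm_num
    · rw [walkCoeff_of_forward (hP s) hs]
      norm_num
  refine ⟨y, ⟨?_, ?_⟩, ?_, ?_⟩
  · intro φ
    have : pair (grad φ) y = ∑ s, - pair (grad φ) (fun i j => walkCoeff (P s) (i, j)) := by
      simp only [pair_eq_sum, hy, ← Finset.sum_neg_distrib, Finset.mul_sum]
      rw [Finset.sum_comm]
      exact Finset.sum_congr rfl fun s _ => Finset.sum_congr rfl fun q _ => by ring
    rw [this, rootDemand]
    refine Finset.sum_congr rfl fun s _ => ?_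
    rw [pair_walkCoeff]
    ring
  · intro q hq
    refine Finset.sum_eq_zero fun s _ => ?_
    rw [walkCoeff_eq_zero_of_notMem _ hq, neg_zero]
  · intro q hq
    have hadj : (edgeGraph B).Adj (inl q.1) (inr q.2) := edgeGraph_adj_inl_inr.2 hq
    rcases path_eq_cons_or hB hadj (hP (inl q.1)) (hP (inr q.2)) with h | h
    · refine (hpos q (inl q.1) ⟨⟨(_, _), hadj⟩, ?_, rfl, rfl⟩).ne'
      rw [h]
      simp
    · refine (hneg q (inr q.2) ⟨⟨(_, _), hadj.symm⟩, ?_, rfl, rfl⟩).ne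
      rw [h]
      simp
  · intro q
    constructor
    · intro hq
      by_contra hcon
      have hb : ∀ s, ¬ Backward (P s) q := fun s hs => hcon ⟨s, P s, hP s, hs⟩
      refine absurd hq (not_lt.2 (Finset.sum_nonneg fun s _ => ?_))
      rw [walkCoeff_of_isPath (hP s), if_neg (hb s)]
      split_ifs <;> norm_num
    · rintro ⟨s, Q, hQ, hb⟩
      rw [path_unique hB hQ (hP s)] at hb
      exact hneg q s hb

end IteratedInsideOut

namespace TransportationProblem

variable {M N : Type*} [Fintype M] [Fintype N]

open IteratedInsideOut
open Sum (inl inr)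

/-! ### Basic feasible solutions -/

/-- The functional of the flows with the supplies and demands of `T`. -/
def supply (T : TransportationProblem M N) (φ : M ⊕ N → ℝ) : ℝ :=
  ∑ i, T.a i * φ (inl i) - ∑ j, T.b j * φ (inr j)

theorem pair_grad (φ : M ⊕ N → ℝ) (x : M → N → ℝ) :
    pair (grad φ) x = ∑ i, (∑ j, x i j) * φ (inl i) - ∑ j, (∑ i, x i j) * φ (inr j) := by
  simp only [pair, grad, Finset.sum_mul]
  rw [Finset.sum_comm (f := fun j i => x i j * φ (inr j)), ← Finset.sum_sub_distrib]
  refine Finset.sum_congr rfl fun i _ => ?_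
  rw [← Finset.sum_sub_distrib]
  exact Finset.sum_congr rfl fun j _ => by ring

/-- The indicator functions of single vertices, used as potentials, give back the individual supply
and demand equations. -/
theorem feasible_iff (T : TransportationProblem M N) (x : M → N → ℝ) :
    T.Feasible x ↔ IsFlow T.supply x ∧ ∀ i j, 0 ≤ x i j := by
  classical
  constructor
  · rintro ⟨ha, hb, hx⟩
    refine ⟨fun φ => ?_, hx⟩
    rw [pair_grad, supply]
    simp only [ha, hb]
  · rintro ⟨h, hx⟩
    refine ⟨fun i => ?_, fun j => ?_, hx⟩
    · have := h (Pi.single (inl i) 1)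
      rw [pair_grad, supply] at this
      simpa [Pi.single_apply] using this
    · have := h (Pi.single (inr j) 1)
      rw [pair_grad, supply] at this
      simpa [Pi.single_apply] using this

theorem isBFS_iff (T : TransportationProblem M N) (B : Finset (M × N)) (x : M → N → ℝ) :
    T.IsBFS B x ↔ (edgeGraph B).IsTree ∧ IsBasicFlow T.supply B x ∧ ∀ i j, 0 ≤ x i j := by
  rw [IsBFS, feasible_iff, IsBasicFlow]
  constructor
  · rintro ⟨h, ⟨h₁, h₂⟩, h₃⟩
    exact ⟨h, ⟨h₁, fun q hq => h₃ _ _ hq⟩, h₂⟩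
  · rintro ⟨h, ⟨h₁, h₃⟩, h₂⟩
    exact ⟨h, ⟨h₁, h₂⟩, fun i j hq => h₃ (i, j) hq⟩

theorem IsBFS.unique {T : TransportationProblem M N} {B : Finset (M × N)} {x y : M → N → ℝ}
    (hx : T.IsBFS B x) (hy : T.IsBFS B y) : x = y := by
  rw [isBFS_iff] at hx hy
  exact hx.2.1.unique hx.1 hy.2.1

/-! ### Multipliers, reduced costs and optimality -/

theorem exists_isMultipliers (T : TransportationProblem M N) {B : Finset (M × N)}
    (hB : (edgeGraph B).IsTree) : ∃ u v, T.IsMultipliers B u v := by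
  obtain ⟨φ, hφ⟩ := exists_potential hB T.c
  -- `grad` subtracts the potential of the destination whereas multipliers are added, hence the
  -- sign.
  refine ⟨fun i => φ (inl i), fun j => - φ (inr j), fun q hq => ?_⟩
  rw [← hφ q hq, grad]
  ring

theorem reducedCost_eq (T : TransportationProblem M N) (u : M → ℝ) (v : N → ℝ) (p : M × N) :
    T.reducedCost u v p = T.c p.1 p.2 - grad (Sum.elim u (fun j => - v j)) p.1 p.2 := by
  simp [reducedCost, grad]
  ring

theorem IsMultipliers.grad_eq {T : TransportationProblem M N} {B : Finset (M × N)} {u : M → ℝ}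
    {v : N → ℝ} (h : T.IsMultipliers B u v) {q : M × N} (hq : q ∈ B) :
    T.c q.1 q.2 = grad (Sum.elim u (fun j => - v j)) q.1 q.2 := by
  rw [← h q hq]
  simp [grad]

/-- Costs of tree edges are potential differences, so the sum along `P` telescopes. Only the basis
matters, so this also applies while the current solution is not basic. -/
theorem cycleCost_eq_reducedCost {T : TransportationProblem M N} {B : Finset (M × N)} {u : M → ℝ}
    {v : N → ℝ} (h : T.IsMultipliers B u v) {p : M × N} (hp : p ∉ B)
    {P : (edgeGraph B).Walk (inl p.1) (inr p.2)} (hP : P.IsPath) :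
    T.cycleCost p P = T.reducedCost u v p := by
  have h₁ : T.cycleCost p P = pair T.c (fun i j => cycleCoeff p P (i, j)) := rfl
  rw [h₁, pair_cycleCoeff hp hP, reducedCost_eq,
    pair_congr (d := grad (Sum.elim u (fun j => - v j))) (fun q hq => h.grad_eq hq)
      (fun q hq => walkCoeff_eq_zero_of_notMem P hq), pair_walkCoeff]
  simp only [grad]
  ring

theorem cost_shift (T : TransportationProblem M N) {B : Finset (M × N)} (x : M → N → ℝ) (p : M × N)
    (P : (edgeGraph B).Walk (inl p.1) (inr p.2)) (k : ℝ) :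
    T.cost (shift x p P k) = T.cost x + k * T.cycleCost p P :=
  pair_shift T.c x P k

/-- Weak duality: the cost of `x` equals the dual value `T.supply φ`, and the cost of any feasible
`y` exceeds this value by the pairing of `y` with the non-negative reduced costs. -/
theorem isOptimal_of_reducedCostsNonneg {T : TransportationProblem M N} {B : Finset (M × N)}
    {x : M → N → ℝ} (hx : T.IsBFS B x) (h : T.ReducedCostsNonneg B) : T.IsOptimal x := by
  refine ⟨hx.2.1, fun y hy => ?_⟩
  obtain ⟨u, v, huv, hr⟩ := h
  set φ := Sum.elim u (fun j => - v j)
  rw [isBFS_iff] at hx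
  rw [feasible_iff] at hy
  have h₁ : T.cost x = T.supply φ := by
    rw [← hx.2.1.1 φ]
    exact pair_congr (fun q hq => huv.grad_eq hq) hx.2.1.2
  have h₂ : 0 ≤ T.cost y - T.supply φ := by
    have h₃ : T.cost y - T.supply φ = pair (fun i j => T.c i j - grad φ i j) y := by
      rw [pair_sub_left, hy.1 φ]
      rfl
    rw [h₃]
    refine Finset.sum_nonneg fun i _ => Finset.sum_nonneg fun j _ => mul_nonneg ?_ (hy.2 i j)
    by_cases hq : (i, j) ∈ B
    · exact (sub_eq_zero.2 (huv.grad_eq hq)).ge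
    · have := hr _ hq
      rwa [reducedCost_eq] at this
  linarith

/-! ### Moving along a cycle -/

theorem Feasible.shift_increase {T : TransportationProblem M N} {x : M → N → ℝ}
    (hx : T.Feasible x) {B : Finset (M × N)} {p : M × N} (hp : p ∉ B)
    {P : (edgeGraph B).Walk (inl p.1) (inr p.2)} (hP : P.IsPath) {k : ℝ} (hk : 0 ≤ k)
    (hmin : ∀ q, Forward P q → k ≤ x q.1 q.2) : T.Feasible (shift x p P k) := by
  rw [feasible_iff] at hx ⊢
  refine ⟨hx.1.shift hp hP k, fun i j => ?_⟩
  have h := hx.2 i j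
  rw [shift]
  by_cases hf : Forward P (i, j)
  · rw [cycleCoeff_of_forward hp hf]
    have := hmin _ hf
    linarith
  · have : 0 ≤ cycleCoeff p P (i, j) := by
      unfold cycleCoeff
      rw [if_neg hf]
      split_ifs <;> norm_num
    positivity

theorem Feasible.shift_decrease {T : TransportationProblem M N} {x : M → N → ℝ}
    (hx : T.Feasible x) {B : Finset (M × N)} {p : M × N} (hp : p ∉ B)
    {P : (edgeGraph B).Walk (inl p.1) (inr p.2)} (hP : P.IsPath) {k : ℝ} (hk : 0 ≤ k)
    (hkp : k ≤ x p.1 p.2) (hmin : ∀ q, Backward P q → k ≤ x q.1 q.2) :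
    T.Feasible (shift x p P (-k)) := by
  rw [feasible_iff] at hx ⊢
  refine ⟨hx.1.shift hp hP _, fun i j => ?_⟩
  have h := hx.2 i j
  rw [shift, cycleCoeff]
  split_ifs with h₁ h₂ h₃
  · rw [← h₁] at hkp
    linarith
  · linarith
  · have := hmin _ h₃
    linarith
  · linarith

theorem NonDegenerate.pos_of_vanish {T : TransportationProblem M N} (hT : T.NonDegenerate)
    {B added : Finset (M × N)} {x : M → N → ℝ} (hB : (edgeGraph B).IsTree) (hx : T.Feasible x)
    (hv : ∀ q ∉ B, q ∉ added → x q.1 q.2 = 0) (hadd : added = ∅) {q : M × N} (hq : q ∈ B) :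
    0 < x q.1 q.2 := by
  subst hadd
  exact hT B x ⟨hB, hx, fun i j h => hv _ h (Finset.notMem_empty _)⟩ q hq

theorem StalledRun.isBFS {T : TransportationProblem M N} {rule : Rule M N} {B : Finset (M × N)}
    {hist : List (Finset (M × N))} (h : T.StalledRun rule (B :: hist)) : ∃ x, T.IsBFS B x := by
  cases h with
  | start B x hx => exact ⟨x, hx⟩
  | move B hist x B' x' h hB hr hx hx' hcost => exact ⟨x', hx'⟩

/-- The number of feasible bases whose objective value is less than `z`. -/
noncomputable def level (T : TransportationProblem M N) (z : ℝ) : ℕ :=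
  {B : Finset (M × N) | ∃ x, T.IsBFS B x ∧ T.cost x < z}.ncard

/-- `B` is counted below `z`, but not below its own cost, since its basic solution is unique. -/
theorem level_lt {T : TransportationProblem M N} {B : Finset (M × N)} {x : M → N → ℝ}
    (hx : T.IsBFS B x) {z : ℝ} (h : T.cost x < z) : T.level (T.cost x) < T.level z := by
  refine Set.ncard_lt_ncard ⟨fun _ ⟨y, hy, hz⟩ => ⟨y, hy, hz.trans h⟩, fun hsub => ?_⟩
    (Set.toFinite _)
  obtain ⟨y, hy, hlt⟩ := hsub ⟨x, hx, h⟩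
  rw [hx.unique hy] at hlt
  exact lt_irrefl _ hlt

end TransportationProblem

namespace TransportationProblem

variable {M N : Type*} [Fintype M] [Fintype N] [DecidableEq M] [DecidableEq N]

open IteratedInsideOut
open Sum (inl inr)

/-! ### The invariant of the algorithm -/

/-- The invariant of the algorithm. -/
def Invariant (T : TransportationProblem M N) (rule : Rule M N) : State M N → Prop
  | .main B x => T.IsBFS B x
  | .phase1 B x z todo added =>
      (edgeGraph B).IsTree ∧ T.Feasible x ∧ (∀ q ∉ B, q ∉ added → x q.1 q.2 = 0) ∧
      (∀ q ∈ added, q ∉ B) ∧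
      (∃ u v, T.IsMultipliers B u v ∧ ∀ p ∈ todo, p ∉ B ∧ T.reducedCost u v p < 0) ∧
      T.cost x ≤ z ∧ (T.NonDegenerate → T.cost x < z ∨ added = ∅ ∧ todo.Nonempty)
  | .phase2 B x z todo =>
      (edgeGraph B).IsTree ∧ T.Feasible x ∧ (∀ q ∉ B, q ∉ todo → x q.1 q.2 = 0) ∧
      (∀ q ∈ todo, q ∉ B) ∧ T.cost x ≤ z ∧ (T.NonDegenerate → T.cost x < z)
  | .antiCycle hist x =>
      ¬ T.NonDegenerate ∧ ∃ B rest, hist = B :: rest ∧ T.IsBFS B x ∧ T.StalledRun rule hist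
  | .halted B x => T.IsBFS B x ∧ T.ReducedCostsNonneg B

/-- A rank that decreases in each step of the algorithm. -/
noncomputable def rank (T : TransportationProblem M N) : State M N → ℕ ×ₗ ℕ ×ₗ ℕ
  | .main _ x => toLex (T.level (T.cost x), toLex (4, 0))
  -- Inside the phases the level is taken at the fixed value `z`, as the cost of the current
  -- solution varies and the solution need not be basic.
  | .phase1 _ _ z todo _ => toLex (T.level z, toLex (3, todo.card))
  | .phase2 _ _ z todo => toLex (T.level z, toLex (2, todo.card))
  | .antiCycle hist x =>
      toLex (T.level (T.cost x), toLex (1, Fintype.card (Finset (M × N)) - hist.length))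
  | .halted _ x => toLex (T.level (T.cost x), toLex (0, 0))

/-! ### Lexicographic descent and the algorithm's steps -/

theorem lex_lt_of_fst {a b : ℕ} (h : a < b) (c d : ℕ ×ₗ ℕ) : toLex (a, c) < toLex (b, d) :=
  Prod.Lex.toLex_lt_toLex.2 (Or.inl h)

theorem lex_lt_of_snd (a : ℕ) {b c : ℕ} (h : b < c) (m n : ℕ) :
    toLex (a, toLex (b, m)) < toLex (a, toLex (c, n)) :=
  Prod.Lex.toLex_lt_toLex.2 (Or.inr ⟨rfl, Prod.Lex.toLex_lt_toLex.2 (Or.inl h)⟩)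

theorem lex_lt_of_trd (a b : ℕ) {m n : ℕ} (h : m < n) :
    toLex (a, toLex (b, m)) < toLex (a, toLex (b, n)) :=
  Prod.Lex.toLex_lt_toLex.2 (Or.inr ⟨rfl, Prod.Lex.toLex_lt_toLex.2 (Or.inr ⟨rfl, h⟩)⟩)

theorem SimplexPivot.cost_le {T : TransportationProblem M N} {B B' : Finset (M × N)}
    {x x' : M → N → ℝ} (hx : T.IsBFS B x) (h : T.SimplexPivot B x B' x') : T.cost x' ≤ T.cost x := by
  obtain ⟨u, v, huv, p, hp, hr, P, hP, q, hq, hmin, rfl, rfl⟩ := h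
  rw [cost_shift, cycleCost_eq_reducedCost huv hp hP]
  have := mul_nonpos_of_nonneg_of_nonpos (hx.2.1.2.2 q.1 q.2) hr.le
  linarith

theorem IsAntiCycling.cost_le {T : TransportationProblem M N} {rule : Rule M N}
    (h : T.IsAntiCycling rule) {B B' : Finset (M × N)} {hist : List (Finset (M × N))}
    {x x' : M → N → ℝ} (hrun : T.StalledRun rule (B :: hist)) (hB : ¬ T.ReducedCostsNonneg B)
    (hr : rule (B :: hist) B') (hx : T.IsBFS B x) (hx' : T.IsBFS B' x') :
    T.cost x' ≤ T.cost x := by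
  obtain ⟨y, y', hy, hy', heq | hpiv⟩ := h.move_valid B hist B' hrun hB hr
  · rw [hx.unique hy, hx'.unique hy', heq]
  · rw [hx.unique hy, hx'.unique hy']
    exact hpiv.cost_le hy

/-- Each step of the algorithm preserves the invariant and decreases the rank. -/
theorem Invariant.step {T : TransportationProblem M N} {rule : Rule M N}
    (hrule : T.NonDegenerate ∨ T.IsAntiCycling rule) {s s' : State M N}
    (hs : T.Invariant rule s) (h : T.Step rule s s') :
    T.Invariant rule s' ∧ T.rank s' < T.rank s := by
  cases h with
  | optimal B x h => exact ⟨⟨hs, h⟩, lex_lt_of_snd _ (by norm_num) _ _⟩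
  | startPhase1 B x u v todo huv htodo hne =>
    exact ⟨⟨hs.1, hs.2.1, fun q hq _ => hs.2.2 _ _ hq, by simp,
      ⟨u, v, huv, fun p hp => (htodo p).1 hp⟩, le_rfl, fun _ => Or.inr ⟨rfl, hne⟩⟩,
      lex_lt_of_snd _ (by norm_num) _ _⟩
  | phase1Blocked B x z todo added p hp P hP hk =>
    obtain ⟨hB, hx, hv, had, ⟨u, v, huv, hr⟩, hz, hnd⟩ := hs
    refine ⟨⟨hB, hx, hv, had, ⟨u, v, huv, fun q hq => hr q (Finset.mem_of_mem_erase hq)⟩, hz,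
      fun hT => Or.inl ?_⟩, lex_lt_of_trd _ _ (Finset.card_erase_lt_of_mem hp)⟩
    -- If nothing has been added yet, `x` is still the basic solution of `B` and is positive on `B`,
    -- so no edge can block.
    refine (hnd hT).resolve_right fun h => ?_
    obtain ⟨q, hq, hq0⟩ := hk.1
    exact (hT.pos_of_vanish hB hx hv h.1 (mem_of_forward hq)).ne' hq0
  | phase1Increase B x z todo added p hp P hP k hk hpos =>
    obtain ⟨hB, hx, hv, had, ⟨u, v, huv, hr⟩, hz, hnd⟩ := hs
    have hpB := (hr p hp).1
    have hlt : T.cost (shift x p P k) < z := by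
      rw [cost_shift, cycleCost_eq_reducedCost huv hpB hP]
      have := mul_neg_of_pos_of_neg hpos (hr p hp).2
      linarith
    refine ⟨⟨hB, hx.shift_increase hpB hP hpos.le fun q hq => hk.2 ⟨q, hq, rfl⟩, ?_, ?_,
      ⟨u, v, huv, fun q hq => hr q (Finset.mem_of_mem_erase hq)⟩, hlt.le, fun _ => Or.inl hlt⟩,
      lex_lt_of_trd _ _ (Finset.card_erase_lt_of_mem hp)⟩
    · intro q hq hqa
      rw [Finset.mem_insert, not_or] at hqa
      rw [shift_eq_of_notMem hq hqa.1]
      exact hv q hq hqa.2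
    · intro q hq
      rcases Finset.mem_insert.1 hq with rfl | hq
      · exact hpB
      · exact had q hq
  | startPhase2 B x z added =>
    obtain ⟨hB, hx, hv, had, -, hz, hnd⟩ := hs
    exact ⟨⟨hB, hx, hv, had, hz, fun hT => (hnd hT).resolve_right fun h => by simp at h⟩,
      lex_lt_of_snd _ (by norm_num) _ _⟩
  | phase2Increase B x z todo p hp P hP hcost q hq hmin =>
    obtain ⟨hB, hx, hv, had, hz, hnd⟩ := hs
    have hpB := had p hp
    have hx0 := hx.2.2 q.1 q.2
    have hle : T.cost (shift x p P (x q.1 q.2)) ≤ T.cost x := by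
      rw [cost_shift]
      have := mul_nonpos_of_nonneg_of_nonpos hx0 hcost
      linarith
    exact ⟨⟨isTree_exchange hB hpB hP (Or.inl hq), hx.shift_increase hpB hP hx0 hmin,
      vanish_exchange hv (by rw [shift_forward hpB hq, sub_self]), notMem_exchange had,
      hle.trans hz, fun hT => hle.trans_lt (hnd hT)⟩,
      lex_lt_of_trd _ _ (Finset.card_erase_lt_of_mem hp)⟩
  | phase2ToZero B x z todo p hp P hP hcost hmin =>
    obtain ⟨hB, hx, hv, had, hz, hnd⟩ := hs
    have hpB := had p hp
    have hx0 := hx.2.2 p.1 p.2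
    have hle : T.cost (shift x p P (-x p.1 p.2)) ≤ T.cost x := by
      rw [cost_shift]
      have := mul_nonneg hx0 hcost.le
      linarith
    refine ⟨⟨hB, hx.shift_decrease hpB hP hx0 le_rfl hmin, ?_,
      fun r hr => had r (Finset.mem_of_mem_erase hr),
      hle.trans hz, fun hT => hle.trans_lt (hnd hT)⟩,
      lex_lt_of_trd _ _ (Finset.card_erase_lt_of_mem hp)⟩
    intro r hr hr'
    by_cases hrp : r = p
    · rw [hrp, shift_self, add_neg_cancel]
    · rw [shift_eq_of_notMem hr hrp]
      exact hv r hr fun h => hr' (Finset.mem_erase.2 ⟨hrp, h⟩)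
  | phase2Decrease B x z todo p hp P hP hcost q hq hmin hqp =>
    obtain ⟨hB, hx, hv, had, hz, hnd⟩ := hs
    have hpB := had p hp
    have hx0 := hx.2.2 q.1 q.2
    have hle : T.cost (shift x p P (-x q.1 q.2)) ≤ T.cost x := by
      rw [cost_shift]
      have := mul_nonneg hx0 hcost.le
      linarith
    exact ⟨⟨isTree_exchange hB hpB hP (Or.inr hq), hx.shift_decrease hpB hP hx0 hqp hmin,
      vanish_exchange hv (by rw [shift_backward hB hpB hP hq, add_neg_cancel]),
      notMem_exchange had, hle.trans hz, fun hT => hle.trans_lt (hnd hT)⟩,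
      lex_lt_of_trd _ _ (Finset.card_erase_lt_of_mem hp)⟩
  | improved B x z h =>
    obtain ⟨hB, hx, hv, -⟩ := hs
    have hBFS : T.IsBFS B x := ⟨hB, hx, fun i j hq => hv _ hq (Finset.notMem_empty _)⟩
    exact ⟨hBFS, lex_lt_of_fst (level_lt hBFS h) _ _⟩
  | stalled B x z h =>
    obtain ⟨hB, hx, hv, -, hz, hnd⟩ := hs
    have hBFS : T.IsBFS B x := ⟨hB, hx, fun i j hq => hv _ hq (Finset.notMem_empty _)⟩
    refine ⟨⟨fun hT => h (hnd hT), B, [], rfl, hBFS, .start B x hBFS⟩, ?_⟩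
    -- A stall means that the cost is exactly `z`: the level stays and the stage number decreases.
    rw [← le_antisymm hz (not_lt.1 h)]
    exact lex_lt_of_snd _ (by norm_num) _ _
  | antiCycleOptimal B hist x h =>
    obtain ⟨-, B₁, rest, heq, hx, -⟩ := hs
    rw [← (List.cons.inj heq).1] at hx
    exact ⟨⟨hx, h⟩, lex_lt_of_snd _ (by norm_num) _ _⟩
  | antiCycleImproved B hist x B' x' hB hr hx' h =>
    exact ⟨hx', lex_lt_of_fst (level_lt hx' h) _ _⟩
  | antiCycleContinue B hist x B' x' hB hr hx' h =>
    obtain ⟨hT, B₁, rest, heq, hx, hrun⟩ := hs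
    rw [← (List.cons.inj heq).1] at hx
    -- The mechanism is active only in degenerate problems, which is why the non-degenerate case
    -- puts no condition on the rule.
    have hac := hrule.resolve_left hT
    have hcost : T.cost x' = T.cost x :=
      le_antisymm (hac.cost_le hrun hB hr hx hx') (not_lt.1 h)
    have hrun' := StalledRun.move B hist x B' x' hrun hB hr hx hx' hcost
    refine ⟨⟨hT, B', _, rfl, hx', hrun'⟩, ?_⟩
    -- Distinct bases are at most as many as the edge sets, so the truncated subtraction in `rank`
    -- really decreases.
    have hlen := (hac.no_cycle _ hrun').length_le_card
    simp only [rank, hcost]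
    refine lex_lt_of_trd _ _ ?_
    simp only [List.length_cons] at hlen ⊢
    omega

/-- The algorithm can continue unless it has halted. -/
theorem Invariant.exists_step {T : TransportationProblem M N} {rule : Rule M N}
    (hrule : T.NonDegenerate ∨ T.IsAntiCycling rule) {s : State M N}
    (hs : T.Invariant rule s) : (∃ s', T.Step rule s s') ∨ ∃ B x, s = .halted B x := by
  classical
  cases s with
  | main B x =>
    left
    obtain ⟨u, v, huv⟩ := T.exists_isMultipliers hs.1
    by_cases h : (Finset.univ.filter (fun p => p ∉ B ∧ T.reducedCost u v p < 0)).Nonempty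
    · exact ⟨_, .startPhase1 B x u v _ huv (fun p => by simp) h⟩
    · refine ⟨_, .optimal B x ⟨u, v, huv, fun p hp => not_lt.1 fun hlt => h ⟨p, ?_⟩⟩⟩
      simp [hp, hlt]
  | phase1 B x z todo added =>
    left
    obtain ⟨hB, hx, -⟩ := hs
    rcases todo.eq_empty_or_nonempty with rfl | ⟨p, hp⟩
    · exact ⟨_, .startPhase2 B x z added⟩
    · obtain ⟨P, hP⟩ := (hB.existsUnique_path (inl p.1) (inr p.2)).exists
      obtain ⟨q, hq, hmin⟩ := exists_min_forward P (fun q => x q.1 q.2)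
      have hk : IsLeast {t | ∃ q, Forward P q ∧ x q.1 q.2 = t} (x q.1 q.2) :=
        ⟨⟨q, hq, rfl⟩, by rintro t ⟨q', hq', rfl⟩; exact hmin q' hq'⟩
      rcases (hx.2.2 q.1 q.2).eq_or_lt with h0 | h0
      · rw [← h0] at hk
        exact ⟨_, .phase1Blocked B x z todo added p hp P hP hk⟩
      · exact ⟨_, .phase1Increase B x z todo added p hp P hP _ hk h0⟩
  | phase2 B x z todo =>
    left
    obtain ⟨hB, hx, -⟩ := hs
    rcases todo.eq_empty_or_nonempty with rfl | ⟨p, hp⟩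
    · by_cases h : T.cost x < z
      · exact ⟨_, .improved B x z h⟩
      · exact ⟨_, .stalled B x z h⟩
    · obtain ⟨P, hP⟩ := (hB.existsUnique_path (inl p.1) (inr p.2)).exists
      rcases le_or_gt (T.cycleCost p P) 0 with hc | hc
      · obtain ⟨q, hq, hmin⟩ := exists_min_forward P (fun q => x q.1 q.2)
        exact ⟨_, .phase2Increase B x z todo p hp P hP hc q hq hmin⟩
      · by_cases h : ∀ q', Backward P q' → x p.1 p.2 ≤ x q'.1 q'.2
        · exact ⟨_, .phase2ToZero B x z todo p hp P hP hc h⟩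
        · push Not at h
          obtain ⟨q₀, hq₀, hlt⟩ := h
          obtain ⟨q, hq, hmin⟩ := Set.exists_min_image {q | Backward P q} (fun q => x q.1 q.2)
            (Set.toFinite _) ⟨q₀, hq₀⟩
          exact ⟨_, .phase2Decrease B x z todo p hp P hP hc q hq hmin ((hmin q₀ hq₀).trans hlt.le)⟩
  | antiCycle hist x =>
    left
    obtain ⟨hT, B, rest, rfl, hx, hrun⟩ := hs
    have hac := hrule.resolve_left hT
    by_cases hB : T.ReducedCostsNonneg B
    · exact ⟨_, .antiCycleOptimal B rest x hB⟩
    · obtain ⟨B', hr⟩ := hac.exists_move B rest hrun hB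
      obtain ⟨-, x', -, hx', -⟩ := hac.move_valid B rest B' hrun hB hr
      by_cases h : T.cost x' < T.cost x
      · exact ⟨_, .antiCycleImproved B rest x B' x' hB hr hx' h⟩
      · exact ⟨_, .antiCycleContinue B rest x B' x' hB hr hx' h⟩
  | halted B x => exact Or.inr ⟨B, x, rfl⟩

theorem solvesToOptimality {T : TransportationProblem M N} {rule : Rule M N}
    (hrule : T.NonDegenerate ∨ T.IsAntiCycling rule) : T.SolvesToOptimality rule := by
  intro B₀ x₀ h₀
  have hreach : ∀ s, Relation.ReflTransGen (T.Step rule) (.main B₀ x₀) s → T.Invariant rule s := by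
    intro s hs
    induction hs with
    | refl => exact h₀
    | tail _ hstep ih => exact (ih.step hrule hstep).1
  refine ⟨?_, fun s hs => (hreach s hs).exists_step hrule, fun B x z hs => ?_, fun B x hs => ?_⟩
  · rintro ⟨run, hrun₀, hrun⟩
    have hinv : ∀ n, T.Invariant rule (run n) := by
      intro n
      induction n with
      | zero =>
        rw [hrun₀]
        exact h₀
      | succ n ih => exact (ih.step hrule (hrun n)).1
    exact not_strictAnti_of_wellFoundedLT (fun n => T.rank (run n))
      (strictAnti_nat_of_succ_lt fun n => ((hinv n).step hrule (hrun n)).2)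
  · obtain ⟨hB, hx, hv, -, hz, -⟩ := hreach _ hs
    exact ⟨⟨hB, hx, fun i j hq => hv _ hq (Finset.notMem_empty _)⟩, hz⟩
  · obtain ⟨hx, hr⟩ := hreach _ hs
    exact ⟨hx, hr, isOptimal_of_reducedCostsNonneg hx hr⟩

end TransportationProblem

namespace TransportationProblem

variable {M N : Type*} [Fintype M] [Fintype N]

open IteratedInsideOut
open Sum (inl inr)

/-! ### Strongly feasible bases -/

/-- A basis is strongly feasible if and only if its basic solution is lexicographically positive
when one unit from each vertex to the root is used as a perturbation. -/
theorem isStronglyFeasible_iff {T : TransportationProblem M N} {root : M ⊕ N} {B : Finset (M × N)}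
    {x y : M → N → ℝ} (hx : T.IsBFS B x) (hy : IsBasicFlow (rootDemand root) B y) :
    T.IsStronglyFeasible root B x ↔ ∀ q ∈ B, x q.1 q.2 = 0 → 0 < y q.1 q.2 := by
  -- The root flow is nonzero on tree edges and negative exactly on those pointing away from the
  -- root. So a zero edge is correctly directed if and only if `y` is positive on it.
  obtain ⟨y', hy', hne, hneg⟩ := exists_rootFlow hx.1 root
  obtain rfl := hy.unique hx.1 hy'
  constructor
  · intro h q hq h0
    refine (lt_or_gt_of_ne (hne q hq)).resolve_left fun hlt => ?_
    obtain ⟨s, P, hP, hb⟩ := (hneg q).1 hlt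
    exact (h.2 s P hP q hb).ne' h0
  · refine fun h => ⟨hx, fun s P hP q hb => (hx.2.1.2.2 q.1 q.2).lt_of_ne fun h0 => ?_⟩
    exact (h q (mem_of_backward hb) h0.symm).not_gt ((hneg q).2 ⟨s, P, hP, hb⟩)

theorem _root_.IteratedInsideOut.IsBasicFlow.exchange [DecidableEq M] [DecidableEq N]
    {D : (M ⊕ N → ℝ) → ℝ} {B : Finset (M × N)}
    {x : M → N → ℝ} (hx : IsBasicFlow D B x) {p q : M × N} (hp : p ∉ B)
    {P : (edgeGraph B).Walk (inl p.1) (inr p.2)} (hP : P.IsPath) (hq : Forward P q) :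
    IsBasicFlow D (insert p (B.erase q)) (shift x p P (x q.1 q.2)) :=
  ⟨hx.1.shift hp hP _, fun r hr => vanish_exchange (todo := ∅) (fun r hr _ => hx.2 r hr)
    (by rw [shift_forward hp hq, sub_self]) r hr (by simp)⟩

/-- The leaving edge minimises `(x, y)` lexicographically over the decreasing edges. This respects
the ordinary ratio test and breaks its ties so that the new pair is again lexicographically
positive. -/
theorem IsStronglyFeasible.exists_pivot [DecidableEq M] [DecidableEq N]
    {T : TransportationProblem M N} {root : M ⊕ N}
    {B : Finset (M × N)} {x : M → N → ℝ} (h : T.IsStronglyFeasible root B x)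
    (hB : ¬ T.ReducedCostsNonneg B) :
    ∃ B' x', T.IsStronglyFeasible root B' x' ∧ T.SimplexPivot B x B' x' := by
  have hx := h.1
  obtain ⟨y, hy, -⟩ := exists_rootFlow hx.1 root
  have hpos := (isStronglyFeasible_iff hx hy).1 h
  obtain ⟨u, v, huv⟩ := T.exists_isMultipliers hx.1
  obtain ⟨p, hp, hr⟩ : ∃ p, p ∉ B ∧ T.reducedCost u v p < 0 := by
    by_contra hcon
    push Not at hcon
    exact hB ⟨u, v, huv, hcon⟩
  obtain ⟨P, hP⟩ := (hx.1.existsUnique_path (inl p.1) (inr p.2)).exists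
  obtain ⟨q, hq, hlex⟩ := exists_min_forward P (fun q => toLex (x q.1 q.2, y q.1 q.2))
  have hmin : ∀ q', Forward P q' → x q.1 q.2 ≤ x q'.1 q'.2 := fun q' hq' =>
    (Prod.Lex.toLex_le_toLex.1 (hlex q' hq')).elim le_of_lt fun h => h.1.le
  have hqB := mem_of_forward hq
  have hx0 := hx.2.1.2.2
  have hB' := isTree_exchange hx.1 hp hP (Or.inl hq)
  have hxB' := (((isBFS_iff _ _ _).1 hx).2.1).exchange hp hP hq
  have hyB' := hy.exchange hp hP hq
  have hBFS : T.IsBFS (insert p (B.erase q)) (shift x p P (x q.1 q.2)) :=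
    ⟨hB', hx.2.1.shift_increase hp hP (hx0 _ _) hmin, fun i j hq => hxB'.2 _ hq⟩
  refine ⟨_, _, (isStronglyFeasible_iff hBFS hyB').2 fun r hr h0 => ?_,
    u, v, huv, p, hp, hr, P, hP, q, hq, hmin, rfl, rfl⟩
  rcases Finset.mem_insert.1 hr with rfl | hrB
  · rw [shift_self, hx.2.2 _ _ hp, zero_add] at h0
    rw [shift_self, hy.2 _ hp, zero_add]
    exact hpos q hqB h0
  · have hrB := Finset.mem_of_mem_erase hrB
    have hrp : r ≠ p := fun h => hp (h ▸ hrB)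
    by_cases hf : Forward P r
    · rw [shift_forward hp hf, sub_eq_zero] at h0
      -- A tie in both `x` and `y` would make the new root flow vanish on the tree edge `r`, which
      -- is impossible.
      obtain ⟨y', hy', hne, -⟩ := exists_rootFlow hB' root
      have hr0 := hne r hr
      rw [← hyB'.unique hB' hy', shift_forward hp hf] at hr0
      rw [shift_forward hp hf]
      refine lt_of_le_of_ne (sub_nonneg.2 ?_) hr0.symm
      exact ((Prod.Lex.toLex_le_toLex.1 (hlex r hf)).resolve_left (by simp [h0])).2
    · by_cases hb : Backward P r
      · rw [shift_backward hx.1 hp hP hb] at h0 ⊢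
        have h₁ := hx0 r.1 r.2
        have h₂ := hx0 q.1 q.2
        exact add_pos (hpos r hrB (by linarith)) (hpos q hqB (by linarith))
      · rw [shift, cycleCoeff_eq_zero hrp hf hb, mul_zero, add_zero] at h0 ⊢
        exact hpos r hrB h0

/-- When all supplies and demands are positive, every basic feasible solution has a strongly
feasible basis. -/
theorem exists_isStronglyFeasible {T : TransportationProblem M N} (ha : ∀ i, 0 < T.a i)
    (hb : ∀ j, 0 < T.b j) (root : M ⊕ N) {B : Finset (M × N)} {x : M → N → ℝ} (hx : T.IsBFS B x) :
    ∃ B', T.IsStronglyFeasible root B' x := by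
  classical
  have hx0 := hx.2.1.2.2
  have hrow : ∀ i, ∃ j, 0 < x i j := fun i => by
    have := ha i
    rw [← hx.2.1.1 i] at this
    obtain ⟨j, -, hj⟩ := (Finset.sum_pos_iff_of_nonneg fun j _ => hx0 i j).1 this
    exact ⟨j, hj⟩
  have hcol : ∀ j, ∃ i, 0 < x i j := fun j => by
    have := hb j
    rw [← hx.2.1.2.1 j] at this
    obtain ⟨i, -, hi⟩ := (Finset.sum_pos_iff_of_nonneg fun i _ => hx0 i j).1 this
    exact ⟨i, hi⟩
  -- The destination `d` is the root, or is joined to the root by an edge of positive value.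
  obtain ⟨d, hd⟩ : ∃ d : N, root = inr d ∨ ∃ s, root = inl s ∧ 0 < x s d := by
    rcases root with s | d
    · obtain ⟨d, hd⟩ := hrow s
      exact ⟨d, Or.inr ⟨s, rfl, hd⟩⟩
    · exact ⟨d, Or.inl rfl⟩
  -- `F` is a forest, being part of `B`. `S` adds all edges at `d` and is connected, since every
  -- destination receives flow from some source. In a spanning tree between `F` and `S`, zero edges
  -- occur only at `d`.
  set F : Finset (M × N) := Finset.univ.filter fun q => 0 < x q.1 q.2 with hF
  set S : Finset (M × N) := Finset.univ.filter fun q => 0 < x q.1 q.2 ∨ q.2 = d with hS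
  have hFB : F ⊆ B := fun q hq => by
    by_contra hqB
    exact (Finset.mem_filter.1 hq).2.ne' (hx.2.2 _ _ hqB)
  have hFS : F ⊆ S := fun q hq => by
    simp only [hF, hS, Finset.mem_filter] at hq ⊢
    exact ⟨hq.1, Or.inl hq.2⟩
  have hSconn : (edgeGraph S).Connected := by
    have h₁ : ∀ i, (edgeGraph S).Reachable (inl i) (inr d) := fun i =>
      (edgeGraph_adj_inl_inr.2 (by simp [hS])).reachable
    have h₂ : ∀ v, (edgeGraph S).Reachable v (inr d) := by
      rintro (i | j)
      · exact h₁ i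
      · obtain ⟨i, hi⟩ := hcol j
        have : (edgeGraph S).Adj (inl i) (inr j) := edgeGraph_adj_inl_inr.2 (by simp [hS, hi])
        exact this.symm.reachable.trans (h₁ i)
    have : Nonempty (M ⊕ N) := ⟨root⟩
    exact ⟨fun v w => (h₂ v).trans (h₂ w).symm⟩
  obtain ⟨G, hFG, hGS, hG⟩ := hSconn.exists_isTree_le_of_le_of_isAcyclic (edgeGraph_mono hFS)
    (hx.1.isAcyclic.anti (edgeGraph_mono hFB))
  obtain ⟨B', rfl⟩ : ∃ B' : Finset (M × N), edgeGraph B' = G := by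
    refine ⟨Finset.univ.filter fun q => G.Adj (inl q.1) (inr q.2), ?_⟩
    ext s t
    rw [edgeGraph_adj]
    constructor
    · rintro ⟨q, hq, ⟨rfl, rfl⟩ | ⟨rfl, rfl⟩⟩
      · exact (Finset.mem_filter.1 hq).2
      · exact (Finset.mem_filter.1 hq).2.symm
    · intro h
      obtain ⟨q, -, ⟨rfl, rfl⟩ | ⟨rfl, rfl⟩⟩ := edgeGraph_adj.1 (hGS h)
      · exact ⟨q, by simpa using h, Or.inl ⟨rfl, rfl⟩⟩
      · exact ⟨q, by simpa using h.symm, Or.inr ⟨rfl, rfl⟩⟩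
  have hmem : ∀ i j, 0 < x i j → (i, j) ∈ B' := fun i j h =>
    edgeGraph_adj_inl_inr.1 (hFG (edgeGraph_adj_inl_inr.2 (by simp [hF, h])))
  refine ⟨B', ⟨hG, hx.2.1, fun i j h => ?_⟩, fun s P hP q hq => ?_⟩
  · by_contra hne
    exact h (hmem i j ((hx0 i j).lt_of_ne (Ne.symm hne)))
  · have hqS : q ∈ S := edgeGraph_adj_inl_inr.1
      (hGS (edgeGraph_adj_inl_inr.2 (mem_of_backward hq)))
    by_contra hx'
    have hqd : q.2 = d := (Finset.mem_filter.1 hqS).2.resolve_left hx'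
    obtain ⟨e, he, h₁, h₂⟩ := hq
    obtain ⟨R, hR, hR'⟩ := exists_path_of_dart hP he
    rw [hqd] at h₁
    -- The path leaves `d` through the zero edge `q`. If `d` is the root, the path should have ended
    -- there; otherwise the rest of the path is the positive edge to the root, which would have to
    -- be `q`.
    rcases hd with rfl | ⟨i, rfl, hi⟩
    · rw [h₁] at hR'
      exact hR' R.end_mem_support
    · have hadj : (edgeGraph B').Adj e.fst (inl i) := by
        rw [h₁]
        exact (edgeGraph_adj_inl_inr.2 (hmem i d hi)).symm
      have hsnd : e.snd = inl i := by
        simpa using congrArg (fun W => W.getVert 1)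
          (path_unique hG (hR.cons hR' (h := e.adj)) (SimpleGraph.Walk.IsPath.of_adj hadj))
      rw [h₂] at hsnd
      rw [hqd, Sum.inl.inj hsnd] at hx'
      exact hx' hi

/-! ### Anti-cycling by strongly feasible bases -/

variable [DecidableEq M] [DecidableEq N]

/-- With equal costs the pivot is degenerate, so the leaving edge has value zero and, by strong
feasibility, positive root flow. The root flow is shifted by this amount along a cycle of negative
cost. -/
theorem IsStronglyFeasible.pair_rootFlow_lt {T : TransportationProblem M N} {root : M ⊕ N}
    {B B' : Finset (M × N)} {x x' y y' : M → N → ℝ} (h : T.IsStronglyFeasible root B x)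
    (h' : T.IsBFS B' x') (hpiv : T.SimplexPivot B x B' x') (hcost : T.cost x' = T.cost x)
    (hy : IsBasicFlow (rootDemand root) B y) (hy' : IsBasicFlow (rootDemand root) B' y') :
    pair T.c y' < pair T.c y := by
  obtain ⟨u, v, huv, p, hp, hr, P, hP, q, hq, hmin, rfl, rfl⟩ := hpiv
  rw [cost_shift, cycleCost_eq_reducedCost huv hp hP, add_eq_left, mul_eq_zero] at hcost
  have hpos := (isStronglyFeasible_iff h.1 hy).1 h q (mem_of_forward hq)
    (hcost.resolve_right hr.ne)
  rw [hy'.unique h'.1 (hy.exchange hp hP hq), pair_shift]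
  have := mul_neg_of_pos_of_neg hpos hr
  rw [← cycleCost_eq_reducedCost huv hp hP] at this
  exact add_lt_of_neg_right _ this

/-- The cost of the root flow strictly decreases along the strongly feasible bases of the run. Only
the basis at which the mechanism starts can fail to be strongly feasible, and the rule never moves
to such a basis. -/
theorem stronglyFeasibleRule_stalledRun {T : TransportationProblem M N} {root : M ⊕ N}
    {hist : List (Finset (M × N))} (hrun : T.StalledRun (T.stronglyFeasibleRule root) hist) :
    hist.Nodup ∧ ∀ B rest, hist = B :: rest →
      (rest ≠ [] → ∃ x, T.IsStronglyFeasible root B x) ∧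
      ∀ B₁ ∈ rest, (∃ x, T.IsStronglyFeasible root B₁ x) →
        ∀ y y₁, IsBasicFlow (rootDemand root) B y → IsBasicFlow (rootDemand root) B₁ y₁ →
          pair T.c y < pair T.c y₁ := by
  induction hrun with
  | start B x hx =>
    refine ⟨List.nodup_singleton _, fun B₁ rest h => ?_⟩
    obtain ⟨-, rfl⟩ := List.cons.inj h
    simp
  | move B hist x B' x' hrun hB hr hx hx' hcost ih =>
    obtain ⟨hnd, ih⟩ := ih
    obtain ⟨ihs, ihlt⟩ := ih B hist rfl
    obtain ⟨B₁, rest, z, z', heq, hz, hz', hor⟩ := hr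
    obtain ⟨rfl, rfl⟩ := List.cons.inj heq
    obtain rfl := hx.unique hz
    obtain rfl := hx'.unique hz'.1
    have key : ∀ B₁ ∈ B :: hist, (∃ x, T.IsStronglyFeasible root B₁ x) →
        ∀ y y₁, IsBasicFlow (rootDemand root) B' y → IsBasicFlow (rootDemand root) B₁ y₁ →
          pair T.c y < pair T.c y₁ := by
      intro B₁ hB₁ hs y y₁ hy hy₁
      rcases hor with ⟨hns, -⟩ | ⟨hs', hpiv⟩
      · have hns' : ¬ ∃ x, T.IsStronglyFeasible root B x := by
          rintro ⟨w, hw⟩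
          exact hns (hx.unique hw.1 ▸ hw)
        -- A change of basis without pivot can only be the first move, so there is no earlier
        -- strongly feasible basis to compare with.
        have hnil : hist = [] := by
          by_contra h
          exact hns' (ihs h)
        rw [hnil, List.mem_singleton] at hB₁
        exact absurd (hB₁ ▸ hs) hns'
      · obtain ⟨yB, hyB, -⟩ := exists_rootFlow hx.1 root
        have hlt := hs'.pair_rootFlow_lt hx' hpiv hcost hyB hy
        rcases List.mem_cons.1 hB₁ with rfl | hB₁
        · rwa [hy₁.unique hx.1 hyB]
        · exact hlt.trans (ihlt B₁ hB₁ hs yB y₁ hyB hy₁)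
    refine ⟨List.nodup_cons.2 ⟨fun hmem => ?_, hnd⟩, fun B₂ rest₂ h => ?_⟩
    · obtain ⟨y, hy, -⟩ := exists_rootFlow hx'.1 root
      exact lt_irrefl _ (key B' hmem ⟨_, hz'⟩ y y hy hy)
    · obtain ⟨rfl, rfl⟩ := List.cons.inj h
      exact ⟨fun _ => ⟨_, hz'⟩, key⟩

theorem isAntiCycling_stronglyFeasibleRule {T : TransportationProblem M N} (ha : ∀ i, 0 < T.a i)
    (hb : ∀ j, 0 < T.b j) (root : M ⊕ N) : T.IsAntiCycling (T.stronglyFeasibleRule root) where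
  exists_move B hist hrun hB := by
    obtain ⟨x, hx⟩ := hrun.isBFS
    by_cases hs : T.IsStronglyFeasible root B x
    · obtain ⟨B', x', hs', hpiv⟩ := hs.exists_pivot hB
      exact ⟨B', B, hist, x, x', rfl, hx, hs', Or.inr ⟨hs, hpiv⟩⟩
    · obtain ⟨B', hs'⟩ := exists_isStronglyFeasible ha hb root hx
      exact ⟨B', B, hist, x, x, rfl, hx, hs', Or.inl ⟨hs, rfl⟩⟩
  move_valid := by
    rintro B hist B' - - ⟨B₁, rest, x, x', heq, hx, hs', hor⟩
    obtain ⟨rfl, rfl⟩ := List.cons.inj heq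
    exact ⟨x, x', hx, hs'.1, hor.imp And.right And.right⟩
  no_cycle hist hrun := (stronglyFeasibleRule_stalledRun hrun).1

end TransportationProblem

theorem proposition1 {M N : Type*} [Fintype M] [Fintype N] [DecidableEq M] [DecidableEq N]
    (T : TransportationProblem M N) :
    -- without degeneracy, no property of the anti-cycling mechanism is needed
    (T.NonDegenerate → ∀ rule : IteratedInsideOut.Rule M N, T.SolvesToOptimality rule) ∧
    -- in general, any anti-cycling mechanism will do
    (∀ rule : IteratedInsideOut.Rule M N, T.IsAntiCycling rule → T.SolvesToOptimality rule) ∧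
    -- strongly feasible bases are such a mechanism
    ((∀ i, 0 < T.a i) → (∀ j, 0 < T.b j) → ∀ root : M ⊕ N,
      T.IsAntiCycling (T.stronglyFeasibleRule root)) := by
  exact ⟨fun h rule => TransportationProblem.solvesToOptimality (Or.inl h),
    fun rule h => TransportationProblem.solvesToOptimality (Or.inr h),
    fun ha hb root => TransportationProblem.isAntiCycling_stronglyFeasibleRule ha hb root⟩
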